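/- **Setting.** Let $V$ be a real Hilbert space continuously and injectively embedded in a real inner product space $H$ with inner product $\langle\cdot,\cdot\rangle$ (for instance $V=H^1(\mathbb R^3)$ or a closed subspace of it, and $H=L_2(\mathbb R^3)$). Embed $V$ into its dual $V'$ by $v\mapsto\langle v,\cdot\rangle$, and write $\langle f,v\rangle$ also for the dual pairing. Let $N\in\mathbb N$. For $\Phi=(\varphi_1,\dots,\varphi_N)$ in $V^N$ or $(V')^N$ and $M\in\mathbb R^{N\times N}$ put $(\Phi M)_j=\sum_i m_{ij}\varphi_i$, and put $\langle\langle F,\Phi\rangle\rangle=\sum_i\langle F_i,\varphi_i\rangle$ for $F\in (V')^N$, $\Phi\in V^N$. Let $\mathcal V=\{\Phi\in V^N:\langle\varphi_i,\varphi_j\rangle=\delta_{ij}\}$ (the Stiefel manifold). For $\Phi\in\mathcal V$ let $D_\Phi$ be the $\langle\cdot,\cdot\rangle$-orthogonal projector onto $\operatorname{span}\{\varphi_i\}$, $D_\Phi f=\sum_i\langle f,\varphi_i\rangle\varphi_i$ for $f\in V$ or $f\in V'$, and let $\mathcal T_{[\Phi]}\mathcal G=\{W\in V^N:\langle w_i,\varphi_j\rangle=0\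 \forall i,j\}$ be the tangent space of the Grassmann manifold $\mathcal V/O(N)$ at $[\Phi]$. Operators on $V$ or $V'$ act on families componentwise. Let $\mathcal J:V^N\to\mathbb R$ satisfy $\mathcal J(\Phi U)=\mathcal J(\Phi)$ for all $\Phi\in V^N$, $U\in O(N)$. Let $\Psi\in\mathcal V$ be a minimizer of $\mathcal J$ over $\mathcal V$, and let $\mathcal J$ be twice continuously (Fréchet) differentiable in a neighbourhood of $\Psi$ in $V^N$. For $\Phi\in V^N$ let $\Lambda_\Phi=(\langle\mathcal J'(\Phi)_j,\varphi_i\rangle)_{i,j}$ and $\Lambda=\Lambda_\Psi$; write $D=D_\Psi$. Let $B_0:V\to V'$ be bounded, linear and symmetric with $\vartheta\|v\|_V^2\le\langle B_0v,v\rangle\le\Theta\|v\|_V^2$ for all $v\in V$, for some constants $\vartheta>0$ and $\Theta$. The preconditioner is a scaled variant $B=\alpha B_0$, $\alpha>0$. Let $\hat B:V\to V'$ be the inverse of $\hat B^{-1}=(I-D)B^{-1}(I-D)+D:V'\to V$, and put $\|\Phi\|_{V^N}^2=\langle\langle\hat B\Phi,\Phi\rangle\rangle$ and $d([\Phi],[\Psi])=\inf_{U\in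 O(N)}\|\Phi-\Psi U\|_{V^N}$. **Algorithms.** Start from $\Phi^{(0)}\in\mathcal V$. 1. *(Projected preconditioned gradient descent)* $\hat\Phi^{(n+1)}=\Phi^{(n)}-B^{-1}\big(\mathcal J'(\Phi^{(n)})-\Phi^{(n)}\Lambda_{\Phi^{(n)}}\big)$, and $\Phi^{(n+1)}\in\mathcal V$ is any orthonormalization of $\hat\Phi^{(n+1)}$, that is, any element of $\mathcal V$ with the same span. 2. *(Modified projected gradient descent)* The same with $\hat\Phi^{(n+1)}=\Phi^{(n)}-(I-D_{\Phi^{(n)}})B^{-1}\big(\mathcal J'(\Phi^{(n)})-\Phi^{(n)}\Lambda_{\Phi^{(n)}}\big)$. 3. *(Preconditioned geodesic steps of stepsize $s>0$; for the case that for each $\Phi\in\mathcal V$ at which $\mathcal J$ is differentiable there is a bounded linear $A_\Phi:V\to V'$ with $\mathcal J'(\Phi)=(A_\Phi\varphi_1,\dots,A_\Phi\varphi_N)$)* $\Phi^{(n+1)}=\exp(-s\hat X)\Phi^{(n)}$, where, with $\Phi=\Phi^{(n)}$, $X=(I-D_\Phi)B^{-1}(I-D_\Phi)A_\Phi$ and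 $\hat X=(I-D_\Phi)XD_\Phi-D_\Phi X^\dagger(I-D_\Phi)$; here $X^\dagger:V'\to V'$ is given by $\langle X^\dagger f,v\rangle=\langle f,Xv\rangle$. **Theorem 5.1.** Assume that the Hessian of the Lagrangian is $V^N$-elliptic on the tangent space at $\Psi$: there is $\gamma>0$ with $$\langle\langle\mathcal J''(\Psi)\delta\Phi-\delta\Phi\,\Lambda,\ \delta\Phi\rangle\rangle\ \ge\ \gamma\sum_i\|\delta\varphi_i\|_V^2\qquad\text{for all }\delta\Phi\in\mathcal T_{[\Psi]}\mathcal G .$$ Then each of the three algorithms converges linearly for a suitably scaled preconditioner and a starting point sufficiently close to $\Psi$. Precisely, there is $\alpha_0>0$ such that for every $\alpha\ge\alpha_0$ (Algorithms 1 and 2), respectively for all $\alpha,s>0$ with $\alpha\ge\alpha_0 s$ (Algorithm 3), there are $\delta>0$ and $\chi\in[0,1)$ such that for $B=\alpha B_0$, for every $\Phi^{(0)}\in\mathcal V$ with $d([\Phi^{(0)}],[\Psi])<\delta$ and for every sequence of iterates $\Phi^{(n)}$ of the algorithm started at $\Phi^{(0)}$ (whatever orthonormalizations are used), $$\|(I-D)\Phi^{(n+1)}\|_{V^N}\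 \le\ \chi\,\|(I-D)\Phi^{(n)}\|_{V^N}\qquad\text{for all }n\in\mathbb N_0 .$$ Moreover, in Algorithms 1 and 2 the family $\hat\Phi^{(n+1)}$ is linearly independent for every $n$, so that the orthonormalization is always possible. -/

import Mathlib

noncomputable section

namespace Grassmann

variable {V H : Type*} [NormedAddCommGroup V] [InnerProductSpace ℝ V]
  [NormedAddCommGroup H] [InnerProductSpace ℝ H] {N : ℕ}

/-! Throughout, `ι : V →L[ℝ] H` is the embedding of the energy space `V` into the space `H`
whose inner product is the `L₂` inner product `⟨·,·⟩`, and `V'` is `StrongDual ℝ V`.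
Elements of `V^N` are families `Fin N → V`, elements of `(V^N)' = (V')^N` are families
`Fin N → StrongDual ℝ V`. -/

/-- The embedding `V → V'` of the Gelfand triple, `⟨toDual v, w⟩ = ⟨v, w⟩_{L₂}`. -/
def toDual (ι : V →L[ℝ] H) : V →L[ℝ] StrongDual ℝ V :=
  LinearMap.mkContinuous₂
    (LinearMap.mk₂ ℝ (fun v w : V => inner ℝ (ι v) (ι w))
      (by intro x y z; simp [inner_add_left]) (by intro c x y; simp [inner_smul_left])
      (by intro x y z; simp [inner_add_right]) (by intro c x y; simp [inner_smul_right]))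
    (‖ι‖ * ‖ι‖)
    (by
      intro x y
      calc ‖inner ℝ (ι x) (ι y)‖ ≤ ‖ι x‖ * ‖ι y‖ := norm_inner_le_norm _ _
        _ ≤ (‖ι‖ * ‖x‖) * (‖ι‖ * ‖y‖) := by
            gcongr
            · exact ι.le_opNorm x
            · exact ι.le_opNorm y
        _ = ‖ι‖ * ‖ι‖ * ‖x‖ * ‖y‖ := by ring)

@[simp] theorem toDual_apply (ι : V →L[ℝ] H) (v w : V) :
    toDual ι v w = inner ℝ (ι v) (ι w) := rfl

/-- The matrix `⟨Φᵀ Ψ⟩ = (⟨φ_i, ψ_j⟩)_{i,j}` of `L₂` inner products. -/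
def gram (ι : V →L[ℝ] H) (Φ Ψ : Fin N → V) : Matrix (Fin N) (Fin N) ℝ :=
  Matrix.of fun i j => inner ℝ (ι (Φ i)) (ι (Ψ j))

/-- The dual pairing `⟪F, Φ⟫ = ∑_i ⟨F_i, φ_i⟩` on `(V')^N × V^N`. -/
def pairing (F : Fin N → StrongDual ℝ V) (Φ : Fin N → V) : ℝ := ∑ i, F i (Φ i)

/-- The family `Φ M`, `(Φ M)_j = ∑_i m_{ij} φ_i`. -/
def mulMat (Φ : Fin N → V) (M : Matrix (Fin N) (Fin N) ℝ) : Fin N → V :=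
  fun j => ∑ i, M i j • Φ i

/-- The Stiefel manifold of `L₂`-orthonormal families in `V^N`. -/
def stiefel (ι : V →L[ℝ] H) (N : ℕ) : Set (Fin N → V) := {Φ | gram ι Φ Φ = 1}

/-- The tangent space at `[Φ]` of the Grassmann manifold (`stiefel` modulo `O(N)`). -/
def tangent (ι : V →L[ℝ] H) (Φ : Fin N → V) : Set (Fin N → V) := {W | gram ι W Φ = 0}

/-- For an orthonormal family `Φ`, the `L₂`-orthogonal projector `D_Φ` onto the span of `Φ`,
as an operator `V' → V`: `D_Φ f = ∑_i ⟨f, φ_i⟩ φ_i`. -/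
def projDual (Φ : Fin N → V) : StrongDual ℝ V →L[ℝ] V :=
  ∑ i, (ContinuousLinearMap.apply ℝ ℝ (Φ i)).smulRight (Φ i)

/-- For an orthonormal family `Φ`, the `L₂`-orthogonal projector `D_Φ` on `V`:
`D_Φ v = ∑_i ⟨v, φ_i⟩ φ_i`. -/
def proj (ι : V →L[ℝ] H) (Φ : Fin N → V) : V →L[ℝ] V := (projDual Φ).comp (toDual ι)

/-- `I - D_Φ` on `V`. -/
def compl (ι : V →L[ℝ] H) (Φ : Fin N → V) : V →L[ℝ] V :=
  ContinuousLinearMap.id ℝ V - proj ι Φ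

/-- `I - D_Φ` on `V'`. -/
def complDual (ι : V →L[ℝ] H) (Φ : Fin N → V) : StrongDual ℝ V →L[ℝ] StrongDual ℝ V :=
  ContinuousLinearMap.id ℝ (StrongDual ℝ V) - (toDual ι).comp (projDual Φ)

/-- The family in `(V')^N` of the components of a functional on `V^N`. -/
def components (F : StrongDual ℝ (Fin N → V)) : Fin N → StrongDual ℝ V :=
  fun i => F.comp (ContinuousLinearMap.single ℝ (fun _ : Fin N => V) i)

/-- The gradient `J'(Φ) ∈ (V')^N`. -/
def grad (J : (Fin N → V) → ℝ) (Φ : Fin N → V) : Fin N → StrongDual ℝ V :=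
  components (fderiv ℝ J Φ)

/-- The matrix `Λ = (⟨J'(Φ)_j, φ_i⟩)_{i,j}`; for a minimizer these are the Lagrange
multipliers. -/
def multiplier (J : (Fin N → V) → ℝ) (Φ : Fin N → V) : Matrix (Fin N) (Fin N) ℝ :=
  Matrix.of fun i j => grad J Φ j (Φ i)

/-- The residual `J'(Φ) - Φ Λ ∈ (V')^N`. -/
def residual (ι : V →L[ℝ] H) (J : (Fin N → V) → ℝ) (Φ : Fin N → V) :
    Fin N → StrongDual ℝ V :=
  fun i => grad J Φ i - toDual ι (mulMat Φ (multiplier J Φ) i)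

/-- The Hessian of the Lagrangian at `Ψ`, `X ↦ J''(Ψ) X - X Λ ∈ (V')^N`. -/
def lagrangeHessian (ι : V →L[ℝ] H) (J : (Fin N → V) → ℝ) (Ψ X : Fin N → V) :
    Fin N → StrongDual ℝ V :=
  fun i => components (fderiv ℝ (fderiv ℝ J) Ψ X) i
    - toDual ι (mulMat X (multiplier J Ψ) i)

/-- `V^N`-ellipticity of the Hessian of the Lagrangian on the Grassmann tangent space. -/
def EllipticOnTangent (ι : V →L[ℝ] H) (J : (Fin N → V) → ℝ) (Ψ : Fin N → V) : Prop :=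
  ∃ γ : ℝ, 0 < γ ∧ ∀ X ∈ tangent ι Ψ,
    γ * ∑ i, ‖X i‖ ^ 2 ≤ pairing (lagrangeHessian ι J Ψ X) X

/-- A preconditioner: a symmetric operator `B : V → V'` whose quadratic form is equivalent to
the squared norm of `V`. -/
def IsPreconditioner (B : V →L[ℝ] StrongDual ℝ V) : Prop :=
  (∀ v w, B v w = B w v) ∧
    ∃ ϑ Θ : ℝ, 0 < ϑ ∧ ∀ v, ϑ * ‖v‖ ^ 2 ≤ B v v ∧ B v v ≤ Θ * ‖v‖ ^ 2

/-- The operator `B̂⁻¹ = (I - D_Ψ) B⁻¹ (I - D_Ψ) + D_Ψ : V' → V`. -/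
def hatInv (ι : V →L[ℝ] H) (B : V →L[ℝ] StrongDual ℝ V) (Ψ : Fin N → V) :
    StrongDual ℝ V →L[ℝ] V :=
  (compl ι Ψ).comp (B.inverse.comp (complDual ι Ψ)) + projDual Ψ

/-- The norm `‖Φ‖_{V^N} = (∑_i ⟨B̂ φ_i, φ_i⟩)^{1/2}`. -/
def normVN (ι : V →L[ℝ] H) (B : V →L[ℝ] StrongDual ℝ V) (Ψ Φ : Fin N → V) : ℝ :=
  √(pairing (fun i => (hatInv ι B Ψ).inverse (Φ i)) Φ)

/-- The error `‖(I - D_Ψ) Φ‖_{V^N}`. -/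
def error (ι : V →L[ℝ] H) (B : V →L[ℝ] StrongDual ℝ V) (Ψ Φ : Fin N → V) : ℝ :=
  normVN ι B Ψ (fun i => compl ι Ψ (Φ i))

/-- The distance `d([Φ], [Ψ]) = inf_{U ∈ O(N)} ‖Φ - Ψ U‖_{V^N}`. -/
def dist (ι : V →L[ℝ] H) (B : V →L[ℝ] StrongDual ℝ V) (Ψ Φ : Fin N → V) : ℝ :=
  ⨅ U : Matrix.orthogonalGroup (Fin N) ℝ,
    normVN ι B Ψ (Φ - mulMat Ψ (U : Matrix (Fin N) (Fin N) ℝ))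

/-- `P` is an orthonormalization: it replaces each linearly independent family by an
`L₂`-orthonormal family with the same span. -/
def IsOrthonormalization (ι : V →L[ℝ] H) (P : (Fin N → V) → (Fin N → V)) : Prop :=
  ∀ Φ : Fin N → V, LinearIndependent ℝ Φ →
    P Φ ∈ stiefel ι N ∧
      Submodule.span ℝ (Set.range (P Φ)) = Submodule.span ℝ (Set.range Φ)

/-- Projected gradient descent, before projection: `Φ - B⁻¹ (J'(Φ) - Φ Λ)`. -/
def step₁ (ι : V →L[ℝ] H) (J : (Fin N → V) → ℝ) (B : V →L[ℝ] StrongDual ℝ V)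
    (Φ : Fin N → V) : Fin N → V :=
  fun i => Φ i - B.inverse (residual ι J Φ i)

/-- Modified projected gradient descent, before projection:
`Φ - (I - D_Φ) B⁻¹ (J'(Φ) - Φ Λ)`. -/
def step₂ (ι : V →L[ℝ] H) (J : (Fin N → V) → ℝ) (B : V →L[ℝ] StrongDual ℝ V)
    (Φ : Fin N → V) : Fin N → V :=
  fun i => Φ i - compl ι Φ (B.inverse (residual ι J Φ i))

/-- The operator `X = (I - D_Φ) B⁻¹ (I - D_Φ) A` on `V`, for `A : V → V'`. -/
def expOp (ι : V →L[ℝ] H) (B A : V →L[ℝ] StrongDual ℝ V) (Φ : Fin N → V) : V →L[ℝ] V :=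
  (compl ι Φ).comp (B.inverse.comp ((complDual ι Φ).comp A))

/-- The adjoint `X† : V' → V'`, `⟨X† f, v⟩ = ⟨f, X v⟩`. -/
def adj (X : V →L[ℝ] V) : StrongDual ℝ V →L[ℝ] StrongDual ℝ V :=
  (ContinuousLinearMap.compL ℝ V V ℝ).flip X

/-- The `L₂`-antisymmetric operator `X̂ = (I - D_Φ) X D_Φ - D_Φ X† (I - D_Φ)` on `V`. -/
def antisymm (ι : V →L[ℝ] H) (Φ : Fin N → V) (X : V →L[ℝ] V) : V →L[ℝ] V :=
  (compl ι Φ).comp (X.comp (proj ι Φ))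
    - (projDual Φ).comp ((adj X).comp ((toDual ι).comp (compl ι Φ)))

/-- The preconditioned geodesic step `exp(-s X̂) Φ` with stepsize `s`. -/
def step₃ (ι : V →L[ℝ] H) (B A : V →L[ℝ] StrongDual ℝ V) (s : ℝ) (Φ : Fin N → V) :
    Fin N → V :=
  fun i => NormedSpace.exp (-(s • antisymm ι Φ (expOp ι B A Φ))) (Φ i)

end Grassmann

end

/-!
Near the minimizer all three algorithms share the same linearization. Every family in the Stiefel
manifold with small normal part `E = (I - D) Φ` can be rotated, by the polar decomposition of
`⟨Ψᵀ Φ⟩`, so that `Φ - Ψ = E + O(‖E‖²)` (`exists_aligned`); the energy of the normal part and the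
steps are equivariant under such rotations. By the first order condition at `Ψ` and because the
residual at `Φ` annihilates the span of `Φ`, the residual equals `(I - D) L E + o(E)`
(`residual_isLittleO`), where `L` is the Hessian of the Lagrangian. Hence each step maps `E` to
`E - s (I - D) B⁻¹ (I - D) L E + o(E)`, with `s = 1` in the first two algorithms
(`step₁_isLittleO`, `step₂_isLittleO`, `geodesicStep_isLittleO`).

The linear part is a contraction in the norm of `B̂` on the tangent space
(`exists_linear_contraction`): since `B̂` inverts `(I - D) B⁻¹ (I - D)` on the complement, the new
squared norm is `⟨B̂ E, E⟩ - 2 s ⟨L E, E⟩ + s² ⟨(I - D) L E, B⁻¹ (I - D) L E⟩`. Ellipticity bounds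
the middle term from below, and for `B = α B₀` the last one is of the order `s² / α`, which is
dominated once `α / s` is large. Neither symmetry of `L` nor of `Λ` enters.

Orthonormalization does not spoil the contraction: the unprojected iterate is close to `Ψ`, so its
Gram matrix is close to the identity, the iterate is linearly independent, and replacing it by an
orthonormal basis of its span costs a factor close to `1` (`energy_orthonormalization_le`). The
geodesic step stays in the Stiefel manifold because the exponential of an `L₂`-antisymmetric
operator is an `L₂`-isometry; the operator depends on `A_Φ` only through the gradient
(`antisymm_expOp_eq_rotation`), so the estimates are uniform in the choice of `A_Φ`. The same
isometries provide the curves that yield the first order condition.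
-/

noncomputable section

namespace Grassmann

variable {V H : Type*} [NormedAddCommGroup V] [InnerProductSpace ℝ V]
  [NormedAddCommGroup H] [InnerProductSpace ℝ H] {N : ℕ}

/-! ### Coercive operators and their inverses -/

/-- Lax-Milgram for operators `V → V'`. -/
theorem isInvertible_of_coercive [CompleteSpace V] {B : V →L[ℝ] StrongDual ℝ V} {c : ℝ}
    (hc : 0 < c) (h : ∀ v, c * ‖v‖ ^ 2 ≤ B v v) : B.IsInvertible := by
  have hcoer : IsCoercive B := ⟨c, hc, fun v => by simpa [pow_two, mul_assoc] using h v⟩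
  refine ⟨hcoer.continuousLinearEquivOfBilin.trans
    (InnerProductSpace.toDual ℝ V).toContinuousLinearEquiv, ?_⟩
  ext v w
  simp

/-- Lax-Milgram for operators `V' → V`. -/
theorem isInvertible_of_coercive_dual [CompleteSpace V] {S : StrongDual ℝ V →L[ℝ] V} {c : ℝ}
    (hc : 0 < c) (h : ∀ f : StrongDual ℝ V, c * ‖f‖ ^ 2 ≤ f (S f)) : S.IsInvertible := by
  let e : V ≃L[ℝ] StrongDual ℝ V := (InnerProductSpace.toDual ℝ V).toContinuousLinearEquiv
  have h1 : (((e : V →L[ℝ] StrongDual ℝ V) ∘L S) ∘L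
      (e : V →L[ℝ] StrongDual ℝ V)).IsInvertible := by
    refine isInvertible_of_coercive hc fun v => ?_
    have := h (e v)
    have hn : ‖e v‖ = ‖v‖ := (InnerProductSpace.toDual ℝ V).norm_map v
    rw [hn] at this
    refine this.trans (le_of_eq ?_)
    simp [e, real_inner_comm]
  rw [ContinuousLinearMap.isInvertible_comp_equiv,
    ContinuousLinearMap.isInvertible_equiv_comp] at h1
  exact h1

theorem IsPreconditioner.isInvertible [CompleteSpace V] {B : V →L[ℝ] StrongDual ℝ V}
    (hB : IsPreconditioner B) : B.IsInvertible := by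
  obtain ⟨-, c, C, hc, h⟩ := hB
  exact isInvertible_of_coercive hc fun v => (h v).1

theorem IsPreconditioner.self_inverse [CompleteSpace V] {B : V →L[ℝ] StrongDual ℝ V}
    (hB : IsPreconditioner B) (f : StrongDual ℝ V) : B (B.inverse f) = f := by
  have := hB.isInvertible.self_comp_inverse
  exact DFunLike.congr_fun this f

theorem IsPreconditioner.inverse_symm [CompleteSpace V] {B : V →L[ℝ] StrongDual ℝ V}
    (hB : IsPreconditioner B) (f g : StrongDual ℝ V) : g (B.inverse f) = f (B.inverse g) := by
  have h := hB.1 (B.inverse f) (B.inverse g)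
  rw [hB.self_inverse, hB.self_inverse] at h
  exact h.symm

theorem IsPreconditioner.inverse_coercive [CompleteSpace V] {B : V →L[ℝ] StrongDual ℝ V}
    (hB : IsPreconditioner B) :
    ∃ c : ℝ, 0 < c ∧ ∀ f : StrongDual ℝ V, c * ‖f‖ ^ 2 ≤ f (B.inverse f) := by
  obtain ⟨ϑ, Θ, hϑ, h⟩ := hB.2
  refine ⟨ϑ / (‖B‖ + 1) ^ 2, by positivity, fun f => ?_⟩
  have h1 := (h (B.inverse f)).1
  rw [hB.self_inverse] at h1
  refine le_trans ?_ h1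
  have h2 : ‖f‖ ≤ (‖B‖ + 1) * ‖B.inverse f‖ := by
    calc ‖f‖ = ‖B (B.inverse f)‖ := by rw [hB.self_inverse]
      _ ≤ ‖B‖ * ‖B.inverse f‖ := B.le_opNorm _
      _ ≤ _ := by gcongr; linarith
  have h3 : ‖f‖ ^ 2 ≤ (‖B‖ + 1) ^ 2 * ‖B.inverse f‖ ^ 2 := by
    rw [← mul_pow]; gcongr
  rw [div_mul_eq_mul_div, div_le_iff₀ (by positivity)]
  calc ϑ * ‖f‖ ^ 2 ≤ ϑ * ((‖B‖ + 1) ^ 2 * ‖B.inverse f‖ ^ 2) := by gcongr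
    _ = _ := by ring

/-- The inverse of a symmetric coercive operator `V' → V` is a preconditioner. -/
theorem isPreconditioner_inverse [CompleteSpace V] {S : StrongDual ℝ V →L[ℝ] V} {c : ℝ}
    (hc : 0 < c) (hS : ∀ f g : StrongDual ℝ V, g (S f) = f (S g))
    (h : ∀ f : StrongDual ℝ V, c * ‖f‖ ^ 2 ≤ f (S f)) :
    IsPreconditioner S.inverse := by
  have hinv := isInvertible_of_coercive_dual hc h
  have hs : ∀ v, S (S.inverse v) = v := fun v => DFunLike.congr_fun hinv.self_comp_inverse v
  refine ⟨fun v w => ?_, c / (‖S‖ + 1) ^ 2, ‖S.inverse‖, by positivity, fun v => ⟨?_, ?_⟩⟩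
  · have := hS (S.inverse v) (S.inverse w)
    rw [hs, hs] at this
    exact this.symm
  · have h1 := h (S.inverse v)
    rw [hs] at h1
    refine le_trans ?_ h1
    have h2 : ‖v‖ ≤ (‖S‖ + 1) * ‖S.inverse v‖ := by
      calc ‖v‖ = ‖S (S.inverse v)‖ := by rw [hs]
        _ ≤ ‖S‖ * ‖S.inverse v‖ := S.le_opNorm _
        _ ≤ _ := by gcongr; linarith
    have h3 : ‖v‖ ^ 2 ≤ (‖S‖ + 1) ^ 2 * ‖S.inverse v‖ ^ 2 := by
      rw [← mul_pow]; gcongr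
    rw [div_mul_eq_mul_div, div_le_iff₀ (by positivity)]
    calc c * ‖v‖ ^ 2 ≤ c * ((‖S‖ + 1) ^ 2 * ‖S.inverse v‖ ^ 2) := by gcongr
      _ = _ := by ring
  · calc S.inverse v v ≤ ‖S.inverse v v‖ := le_abs_self _
      _ ≤ ‖S.inverse v‖ * ‖v‖ := (S.inverse v).le_opNorm v
      _ ≤ ‖S.inverse‖ * ‖v‖ * ‖v‖ := by gcongr; exact S.inverse.le_opNorm v
      _ = _ := by ring

theorem IsPreconditioner.smul {B : V →L[ℝ] StrongDual ℝ V} (hB : IsPreconditioner B) {α : ℝ}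
    (hα : 0 < α) : IsPreconditioner (α • B) := by
  obtain ⟨hs, ϑ, Θ, hϑ, h⟩ := hB
  refine ⟨fun v w => by simp [hs v w], α * ϑ, α * Θ, by positivity, fun v => ?_⟩
  have h1 := (h v).1
  have h2 := (h v).2
  constructor
  · simp only [smul_apply, smul_eq_mul, mul_assoc]; gcongr
  · simp only [smul_apply, smul_eq_mul, mul_assoc]; gcongr

theorem IsPreconditioner.inverse_smul [CompleteSpace V] {B : V →L[ℝ] StrongDual ℝ V}
    (hB : IsPreconditioner B) {α : ℝ} (hα : 0 < α) (f : StrongDual ℝ V) :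
    (α • B).inverse f = α⁻¹ • B.inverse f := by
  rw [(hB.smul hα).isInvertible.inverse_apply_eq]
  simp [hB.self_inverse, smul_smul, hα.ne']

/-! ### The projectors -/

theorem projDual_apply (Φ : Fin N → V) (f : StrongDual ℝ V) :
    projDual Φ f = ∑ i, f (Φ i) • Φ i := by
  simp [projDual]

theorem proj_apply (ι : V →L[ℝ] H) (Φ : Fin N → V) (v : V) :
    proj ι Φ v = ∑ i, (inner ℝ (ι v) (ι (Φ i)) : ℝ) • Φ i := by
  simp [proj, projDual_apply]

theorem compl_apply (ι : V →L[ℝ] H) (Φ : Fin N → V) (v : V) :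
    compl ι Φ v = v - proj ι Φ v := rfl

theorem complDual_apply (ι : V →L[ℝ] H) (Φ : Fin N → V) (f : StrongDual ℝ V) :
    complDual ι Φ f = f - toDual ι (projDual Φ f) := rfl

/-- The projector `I - D_Φ` on `V'` is the transpose of the one on `V`. -/
theorem complDual_apply_apply (ι : V →L[ℝ] H) (Φ : Fin N → V) (f : StrongDual ℝ V) (v : V) :
    complDual ι Φ f v = f (compl ι Φ v) := by
  simp only [complDual_apply, compl_apply, sub_apply, map_sub, toDual_apply,
    proj_apply, projDual_apply, map_sum, map_smul, sum_apply, smul_apply, smul_eq_mul]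
  congr 1
  refine Finset.sum_congr rfl fun i _ => ?_
  rw [real_inner_comm (ι v), mul_comm]

theorem inner_of_mem_stiefel {ι : V →L[ℝ] H} {Φ : Fin N → V} (hΦ : Φ ∈ stiefel ι N)
    (i j : Fin N) : inner ℝ (ι (Φ i)) (ι (Φ j)) = if i = j then (1 : ℝ) else 0 := by
  have := congrFun (congrFun (hΦ : gram ι Φ Φ = 1) i) j
  simpa [gram, Matrix.one_apply] using this

theorem compl_basis {ι : V →L[ℝ] H} {Φ : Fin N → V} (hΦ : Φ ∈ stiefel ι N) (i : Fin N) :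
    compl ι Φ (Φ i) = 0 := by
  simp [compl_apply, proj_apply, inner_of_mem_stiefel hΦ]

theorem inner_compl {ι : V →L[ℝ] H} {Φ : Fin N → V} (hΦ : Φ ∈ stiefel ι N) (v : V) (i : Fin N) :
    inner ℝ (ι (compl ι Φ v)) (ι (Φ i)) = (0 : ℝ) := by
  simp [compl_apply, proj_apply, inner_sub_left, sum_inner, inner_smul_left,
    inner_of_mem_stiefel hΦ]

theorem compl_of_inner_eq_zero {ι : V →L[ℝ] H} {Φ : Fin N → V} {v : V}
    (h : ∀ i, inner ℝ (ι v) (ι (Φ i)) = (0 : ℝ)) : compl ι Φ v = v := by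
  simp [compl_apply, proj_apply, h]

theorem compl_compl {ι : V →L[ℝ] H} {Φ : Fin N → V} (hΦ : Φ ∈ stiefel ι N) (v : V) :
    compl ι Φ (compl ι Φ v) = compl ι Φ v :=
  compl_of_inner_eq_zero (inner_compl hΦ v)

theorem complDual_complDual {ι : V →L[ℝ] H} {Φ : Fin N → V} (hΦ : Φ ∈ stiefel ι N)
    (f : StrongDual ℝ V) : complDual ι Φ (complDual ι Φ f) = complDual ι Φ f := by
  ext v
  simp [complDual_apply_apply, compl_compl hΦ]

theorem projDual_complDual {ι : V →L[ℝ] H} {Φ : Fin N → V} (hΦ : Φ ∈ stiefel ι N)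
    (f : StrongDual ℝ V) : projDual Φ (complDual ι Φ f) = 0 := by
  simp [projDual_apply, complDual_apply_apply, compl_basis hΦ]

theorem mem_tangent_iff {ι : V →L[ℝ] H} {Φ X : Fin N → V} :
    X ∈ tangent ι Φ ↔ ∀ i j, inner ℝ (ι (X i)) (ι (Φ j)) = (0 : ℝ) := by
  constructor
  · intro h i j
    exact congrFun (congrFun (h : gram ι X Φ = 0) i) j
  · intro h
    show gram ι X Φ = 0
    ext i j
    exact h i j

/-! ### The energy norm of the reduced preconditioner -/

/-- The part `(I - D_Φ) B⁻¹ (I - D_Φ)` of `B̂⁻¹` that acts on the complement of the span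
of `Φ`. -/
def reducedInverse (ι : V →L[ℝ] H) (B : V →L[ℝ] StrongDual ℝ V) (Φ : Fin N → V) :
    StrongDual ℝ V →L[ℝ] V :=
  (compl ι Φ).comp (B.inverse.comp (complDual ι Φ))

theorem reducedInverse_apply (ι : V →L[ℝ] H) (B : V →L[ℝ] StrongDual ℝ V) (Φ : Fin N → V)
    (f : StrongDual ℝ V) :
    reducedInverse ι B Φ f = compl ι Φ (B.inverse (complDual ι Φ f)) := rfl

theorem hatInv_symm [CompleteSpace V] (ι : V →L[ℝ] H) {B : V →L[ℝ] StrongDual ℝ V}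
    (hB : IsPreconditioner B) (Ψ : Fin N → V) (f g : StrongDual ℝ V) :
    g (hatInv ι B Ψ f) = f (hatInv ι B Ψ g) := by
  simp only [hatInv, add_apply, ContinuousLinearMap.comp_apply, map_add]
  rw [← complDual_apply_apply, ← complDual_apply_apply, hB.inverse_symm]
  simp [projDual_apply, mul_comm]

theorem hatInv_coercive [CompleteSpace V] (ι : V →L[ℝ] H) {B : V →L[ℝ] StrongDual ℝ V}
    (hB : IsPreconditioner B) (Ψ : Fin N → V) :
    ∃ c : ℝ, 0 < c ∧ ∀ f : StrongDual ℝ V, c * ‖f‖ ^ 2 ≤ f (hatInv ι B Ψ f) := by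
  obtain ⟨c, hc, h⟩ := hB.inverse_coercive
  set M : ℝ := ∑ i, ‖toDual ι (Ψ i)‖ ^ 2 with hM
  have hM0 : 0 ≤ M := by positivity
  refine ⟨(2 / c + 2 * M)⁻¹, by positivity, fun f => ?_⟩
  have key : f (hatInv ι B Ψ f) =
      complDual ι Ψ f (B.inverse (complDual ι Ψ f)) + ∑ i, f (Ψ i) ^ 2 := by
    simp only [hatInv, add_apply, ContinuousLinearMap.comp_apply, map_add]
    rw [← complDual_apply_apply]
    simp [projDual_apply, pow_two]
  have h1 := h (complDual ι Ψ f)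
  have h2 : ‖toDual ι (projDual Ψ f)‖ ^ 2 ≤ (∑ i, f (Ψ i) ^ 2) * M := by
    have : ‖toDual ι (projDual Ψ f)‖ ≤ ∑ i, |f (Ψ i)| * ‖toDual ι (Ψ i)‖ := by
      rw [projDual_apply, map_sum]
      refine (norm_sum_le _ _).trans (Finset.sum_le_sum fun i _ => ?_)
      rw [map_smul, norm_smul, Real.norm_eq_abs]
    calc ‖toDual ι (projDual Ψ f)‖ ^ 2 ≤ (∑ i, |f (Ψ i)| * ‖toDual ι (Ψ i)‖) ^ 2 := by gcongr
      _ ≤ (∑ i, |f (Ψ i)| ^ 2) * ∑ i, ‖toDual ι (Ψ i)‖ ^ 2 := Finset.sum_mul_sq_le_sq_mul_sq _ _ _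
      _ = _ := by simp [hM]
  have h3 : ‖f‖ ≤ ‖complDual ι Ψ f‖ + ‖toDual ι (projDual Ψ f)‖ := by
    calc ‖f‖ = ‖complDual ι Ψ f + toDual ι (projDual Ψ f)‖ := by simp [complDual_apply]
      _ ≤ _ := norm_add_le _ _
  set a := ‖complDual ι Ψ f‖
  set b := ‖toDual ι (projDual Ψ f)‖
  set t := ∑ i, f (Ψ i) ^ 2
  have ht : 0 ≤ t := by positivity
  rw [key, inv_mul_le_iff₀ (by positivity)]
  set u := complDual ι Ψ f (B.inverse (complDual ι Ψ f))
  have hu : 0 ≤ u := le_trans (by positivity) h1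
  have h4 : ‖f‖ ^ 2 ≤ 2 * a ^ 2 + 2 * b ^ 2 := by
    have : ‖f‖ ^ 2 ≤ (a + b) ^ 2 := by gcongr
    nlinarith [sq_nonneg (a - b)]
  have h5 : a ^ 2 ≤ u / c := by rw [le_div_iff₀ hc]; linarith
  calc ‖f‖ ^ 2 ≤ 2 * (u / c) + 2 * (t * M) := by linarith
    _ ≤ (2 / c + 2 * M) * (u + t) := by
      have e1 : 0 ≤ 2 / c * t := by positivity
      have e2 : 0 ≤ 2 * M * u := by positivity
      have : (2 / c + 2 * M) * (u + t) = 2 * (u / c) + 2 * (t * M) + (2 / c * t + 2 * M * u) := by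
        ring
      linarith

/-- The reduced preconditioner `B̂` is again a preconditioner. -/
theorem isPreconditioner_hat [CompleteSpace V] (ι : V →L[ℝ] H) {B : V →L[ℝ] StrongDual ℝ V}
    (hB : IsPreconditioner B) (Ψ : Fin N → V) : IsPreconditioner (hatInv ι B Ψ).inverse := by
  obtain ⟨c, hc, h⟩ := hatInv_coercive ι hB Ψ
  exact isPreconditioner_inverse hc (hatInv_symm ι hB Ψ) h

/-- `B̂` inverts `(I - D) B⁻¹ (I - D)` up to the projector `I - D`. -/
theorem hat_reducedInverse [CompleteSpace V] {ι : V →L[ℝ] H} {B : V →L[ℝ] StrongDual ℝ V}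
    (hB : IsPreconditioner B) {Ψ : Fin N → V} (hΨ : Ψ ∈ stiefel ι N) (f : StrongDual ℝ V) :
    (hatInv ι B Ψ).inverse (reducedInverse ι B Ψ f) = complDual ι Ψ f := by
  obtain ⟨c, hc, h⟩ := hatInv_coercive ι hB Ψ
  rw [(isInvertible_of_coercive_dual hc h).inverse_apply_eq]
  simp [hatInv, reducedInverse_apply, complDual_complDual hΨ, projDual_complDual hΨ]

/-- The squared energy norm `∑ i, ⟨T φ_i, φ_i⟩` of a family. -/
def energy (T : V →L[ℝ] StrongDual ℝ V) (X : Fin N → V) : ℝ := ∑ i, T (X i) (X i)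

theorem energy_nonneg {T : V →L[ℝ] StrongDual ℝ V} (hT : IsPreconditioner T) (X : Fin N → V) :
    0 ≤ energy T X := by
  obtain ⟨-, ϑ, Θ, hϑ, h⟩ := hT
  exact Finset.sum_nonneg fun i _ => le_trans (by positivity) (h (X i)).1

/-- The energy norm and the norm of `V^N` are equivalent. -/
theorem exists_energy_bounds {T : V →L[ℝ] StrongDual ℝ V} (hT : IsPreconditioner T) (N : ℕ) :
    ∃ c C : ℝ, 0 < c ∧ 0 < C ∧
      ∀ X : Fin N → V, c * ‖X‖ ^ 2 ≤ energy T X ∧ energy T X ≤ C * ‖X‖ ^ 2 := by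
  obtain ⟨-, ϑ, Θ, hϑ, h⟩ := hT
  refine ⟨ϑ, N * |Θ| + 1, hϑ, by positivity, fun X => ⟨?_, ?_⟩⟩
  · have hnn : ∀ i, 0 ≤ T (X i) (X i) := fun i => le_trans (by positivity) (h (X i)).1
    have h0 : 0 ≤ energy T X := Finset.sum_nonneg fun i _ => hnn i
    have : ‖X‖ ≤ √(energy T X / ϑ) := by
      rw [pi_norm_le_iff_of_nonneg (Real.sqrt_nonneg _)]
      intro i
      apply Real.le_sqrt_of_sq_le
      rw [le_div_iff₀ hϑ, mul_comm]
      exact (h (X i)).1.trans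
        (Finset.single_le_sum (f := fun i => T (X i) (X i)) (fun j _ => hnn j) (Finset.mem_univ i))
    have h2 : ‖X‖ ^ 2 ≤ energy T X / ϑ := by
      calc ‖X‖ ^ 2 ≤ √(energy T X / ϑ) ^ 2 := by gcongr
        _ = _ := Real.sq_sqrt (by positivity)
    rw [le_div_iff₀ hϑ] at h2
    linarith
  · calc energy T X ≤ ∑ _i : Fin N, |Θ| * ‖X‖ ^ 2 := by
          refine Finset.sum_le_sum fun i _ => (h (X i)).2.trans ?_
          gcongr
          · exact le_abs_self _
          · exact norm_le_pi_norm X i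
      _ = N * |Θ| * ‖X‖ ^ 2 := by simp [mul_assoc]
      _ ≤ _ := by gcongr; linarith

/-- Young's inequality for the energy norm. -/
theorem energy_add_le {T : V →L[ℝ] StrongDual ℝ V} (hT : IsPreconditioner T) {ε : ℝ} (hε : 0 < ε)
    (X Y : Fin N → V) :
    energy T (X + Y) ≤ (1 + ε) * energy T X + (1 + ε⁻¹) * energy T Y := by
  simp only [energy, Finset.mul_sum, ← Finset.sum_add_distrib]
  refine Finset.sum_le_sum fun i _ => ?_
  obtain ⟨hs, ϑ, Θ, hϑ, h⟩ := hT
  have h1 : 0 ≤ T (ε • X i - Y i) (ε • X i - Y i) := le_trans (by positivity) (h _).1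
  have h2 : T (ε • X i - Y i) (ε • X i - Y i) =
      ε * (ε * T (X i) (X i) - 2 * T (X i) (Y i)) + T (Y i) (Y i) := by
    simp only [map_sub, map_smul, sub_apply, smul_apply,
      smul_eq_mul, hs (Y i) (X i)]
    ring
  have h3 : 0 ≤ ε⁻¹ * T (ε • X i - Y i) (ε • X i - Y i) := by positivity
  have h4 : ε⁻¹ * T (ε • X i - Y i) (ε • X i - Y i) =
      ε * T (X i) (X i) - 2 * T (X i) (Y i) + ε⁻¹ * T (Y i) (Y i) := by
    rw [h2]; field_simp
  simp only [Pi.add_apply, map_add, add_apply, hs (Y i) (X i)]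
  linarith

/-- The linearized preconditioned gradient step contracts the energy norm on the tangent space.
The square of the new norm is expanded; the cross term is controlled from below by ellipticity,
and the quadratic term carries the small factor `s / α`. -/
theorem exists_linear_contraction [CompleteSpace V] {ι : V →L[ℝ] H} {B : V →L[ℝ] StrongDual ℝ V}
    (hB : IsPreconditioner B) {Ψ : Fin N → V} (hΨ : Ψ ∈ stiefel ι N)
    (L : (Fin N → V) →L[ℝ] (Fin N → StrongDual ℝ V)) {γ : ℝ} (hγ : 0 < γ)
    (hL : ∀ X ∈ tangent ι Ψ, γ * ∑ i, ‖X i‖ ^ 2 ≤ pairing (L X) X) :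
    ∃ α₀ : ℝ, 0 < α₀ ∧ ∀ α s : ℝ, 0 < s → α₀ * s ≤ α → ∃ κ : ℝ, 0 ≤ κ ∧ κ < 1 ∧
      ∀ X ∈ tangent ι Ψ,
        energy (hatInv ι (α • B) Ψ).inverse
            (fun i => X i - s • reducedInverse ι (α • B) Ψ (L X i)) ≤
          κ * energy (hatInv ι (α • B) Ψ).inverse X := by
  set R : ℝ := ‖complDual ι Ψ‖ * ‖reducedInverse ι B Ψ‖ * (N * ‖L‖ ^ 2) with hR
  have hR0 : 0 ≤ R := by positivity
  refine ⟨(R + 1) / γ, by positivity, fun α s hs hαs => ?_⟩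
  have hα : 0 < α := lt_of_lt_of_le (by positivity) hαs
  have hBα := hB.smul hα
  set T := (hatInv ι (α • B) Ψ).inverse with hTdef
  have hT : IsPreconditioner T := isPreconditioner_hat ι hBα Ψ
  obtain ⟨c, C, hc, hC, hcC⟩ := exists_energy_bounds hT N
  have hsα : s / α * R ≤ γ := by
    rw [div_mul_eq_mul_div, div_le_iff₀ hα]
    have : (R + 1) * s ≤ γ * α := by
      have := mul_le_mul_of_nonneg_left hαs hγ.le
      calc (R + 1) * s = γ * ((R + 1) / γ * s) := by field_simp
        _ ≤ _ := this
    nlinarith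
  refine ⟨max 0 (1 - s * γ / C), le_max_left _ _, max_lt one_pos (by
    have : 0 < s * γ / C := by positivity
    linarith), fun X hX => ?_⟩
  have hXc : ∀ i, compl ι Ψ (X i) = X i := fun i =>
    compl_of_inner_eq_zero (mem_tangent_iff.1 hX i)
  -- the exact expansion of the square
  have hexp : energy T (fun i => X i - s • reducedInverse ι (α • B) Ψ (L X i)) =
      energy T X - 2 * s * pairing (L X) X
        + s ^ 2 * ∑ i, complDual ι Ψ (L X i) (reducedInverse ι (α • B) Ψ (L X i)) := by
    simp only [energy, pairing, Finset.mul_sum, ← Finset.sum_add_distrib, ← Finset.sum_sub_distrib]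
    refine Finset.sum_congr rfl fun i _ => ?_
    have e1 : T (reducedInverse ι (α • B) Ψ (L X i)) = complDual ι Ψ (L X i) :=
      hat_reducedInverse hBα hΨ _
    have e2 : T (X i) (reducedInverse ι (α • B) Ψ (L X i)) = L X i (X i) := by
      rw [hT.1, e1, complDual_apply_apply, hXc]
    have e3 : complDual ι Ψ (L X i) (X i) = L X i (X i) := by
      rw [complDual_apply_apply, hXc]
    simp only [map_sub, map_smul, sub_apply, smul_apply,
      smul_eq_mul, e1, e2, e3]
    ring
  have hquad : ∑ i, complDual ι Ψ (L X i) (reducedInverse ι (α • B) Ψ (L X i)) ≤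
      α⁻¹ * (R * ‖X‖ ^ 2) := by
    have hterm : ∀ i, complDual ι Ψ (L X i) (reducedInverse ι (α • B) Ψ (L X i)) ≤
        α⁻¹ * (‖complDual ι Ψ‖ * ‖reducedInverse ι B Ψ‖ * (‖L‖ * ‖X‖) ^ 2) := by
      intro i
      have e : reducedInverse ι (α • B) Ψ (L X i) = α⁻¹ • reducedInverse ι B Ψ (L X i) := by
        simp [reducedInverse_apply, hB.inverse_smul hα]
      rw [e, map_smul, smul_eq_mul]
      have hLi : ‖L X i‖ ≤ ‖L‖ * ‖X‖ := (norm_le_pi_norm (L X) i).trans (L.le_opNorm X)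
      gcongr
      calc complDual ι Ψ (L X i) (reducedInverse ι B Ψ (L X i))
          ≤ ‖complDual ι Ψ (L X i)‖ * ‖reducedInverse ι B Ψ (L X i)‖ :=
            (le_abs_self _).trans ((complDual ι Ψ (L X i)).le_opNorm _)
        _ ≤ (‖complDual ι Ψ‖ * ‖L X i‖) * (‖reducedInverse ι B Ψ‖ * ‖L X i‖) := by
            gcongr <;> exact ContinuousLinearMap.le_opNorm _ _
        _ ≤ (‖complDual ι Ψ‖ * (‖L‖ * ‖X‖)) * (‖reducedInverse ι B Ψ‖ * (‖L‖ * ‖X‖)) := by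
            gcongr
        _ = _ := by ring
    refine (Finset.sum_le_sum fun i _ => hterm i).trans (le_of_eq ?_)
    simp [hR]; ring
  have hXsq : ‖X‖ ^ 2 ≤ ∑ i, ‖X i‖ ^ 2 := by
    have : ‖X‖ ≤ √(∑ i, ‖X i‖ ^ 2) := by
      rw [pi_norm_le_iff_of_nonneg (Real.sqrt_nonneg _)]
      intro i
      apply Real.le_sqrt_of_sq_le
      exact Finset.single_le_sum (f := fun i => ‖X i‖ ^ 2) (fun j _ => by positivity)
        (Finset.mem_univ i)
    calc ‖X‖ ^ 2 ≤ √(∑ i, ‖X i‖ ^ 2) ^ 2 := by gcongr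
      _ = _ := Real.sq_sqrt (by positivity)
  have hell : γ * ‖X‖ ^ 2 ≤ pairing (L X) X := le_trans (by gcongr) (hL X hX)
  have hfin : energy T (fun i => X i - s • reducedInverse ι (α • B) Ψ (L X i)) ≤
      energy T X - s * γ * ‖X‖ ^ 2 := by
    rw [hexp]
    have e1 : s ^ 2 * ∑ i, complDual ι Ψ (L X i) (reducedInverse ι (α • B) Ψ (L X i)) ≤
        s * γ * ‖X‖ ^ 2 := by
      calc _ ≤ s ^ 2 * (α⁻¹ * (R * ‖X‖ ^ 2)) := by gcongr
        _ = s * (s / α * R) * ‖X‖ ^ 2 := by ring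
        _ ≤ _ := by gcongr
    have e2 : s * (γ * ‖X‖ ^ 2) ≤ s * pairing (L X) X := by gcongr
    nlinarith
  refine hfin.trans (le_trans ?_ (mul_le_mul_of_nonneg_right (le_max_right _ _)
    (energy_nonneg hT X)))
  have : s * γ / C * energy T X ≤ s * γ * ‖X‖ ^ 2 := by
    rw [div_mul_eq_mul_div, div_le_iff₀ hC]
    calc s * γ * energy T X ≤ s * γ * (C * ‖X‖ ^ 2) := by gcongr; exact (hcC X).2
      _ = _ := by ring
  linarith

/-! ### The action of matrices on families -/

theorem mulMat_mulMat (Φ : Fin N → V) (M M' : Matrix (Fin N) (Fin N) ℝ) :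
    mulMat (mulMat Φ M) M' = mulMat Φ (M * M') := by
  ext j
  simp only [mulMat, Finset.smul_sum, smul_smul, Matrix.mul_apply, Finset.sum_smul]
  rw [Finset.sum_comm]
  refine Finset.sum_congr rfl fun i _ => Finset.sum_congr rfl fun k _ => ?_
  rw [mul_comm]

@[simp] theorem mulMat_one (Φ : Fin N → V) : mulMat Φ 1 = Φ := by
  ext j
  simp [mulMat, Matrix.one_apply]

theorem transpose_mul_of_mem {U : Matrix (Fin N) (Fin N) ℝ}
    (hU : U ∈ Matrix.orthogonalGroup (Fin N) ℝ) : U.transpose * U = 1 :=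
  (Matrix.mem_orthogonalGroup_iff' (Fin N) ℝ).1 hU

theorem mul_transpose_of_mem {U : Matrix (Fin N) (Fin N) ℝ}
    (hU : U ∈ Matrix.orthogonalGroup (Fin N) ℝ) : U * U.transpose = 1 :=
  (Matrix.mem_orthogonalGroup_iff (Fin N) ℝ).1 hU

theorem sum_row_mul_row {U : Matrix (Fin N) (Fin N) ℝ}
    (hU : U ∈ Matrix.orthogonalGroup (Fin N) ℝ) (i k : Fin N) :
    ∑ j, U i j * U k j = if i = k then (1 : ℝ) else 0 := by
  have := congrFun (congrFun (mul_transpose_of_mem hU) i) k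
  simpa [Matrix.mul_apply, Matrix.one_apply] using this

theorem sum_sq_sum_mul {U : Matrix (Fin N) (Fin N) ℝ}
    (hU : U ∈ Matrix.orthogonalGroup (Fin N) ℝ) (x : Fin N → ℝ) :
    ∑ j, (∑ i, x i * U i j) ^ 2 = ∑ i, x i ^ 2 := by
  have h := sum_row_mul_row hU
  calc ∑ j, (∑ i, x i * U i j) ^ 2 = ∑ j, ∑ i, ∑ k, (x i * x k) * (U i j * U k j) := by
        refine Finset.sum_congr rfl fun j _ => ?_
        rw [pow_two, Finset.sum_mul_sum]
        refine Finset.sum_congr rfl fun i _ => Finset.sum_congr rfl fun k _ => ?_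
        ring
    _ = ∑ i, ∑ k, (x i * x k) * ∑ j, U i j * U k j := by
        rw [Finset.sum_comm]
        refine Finset.sum_congr rfl fun i _ => ?_
        rw [Finset.sum_comm]
        refine Finset.sum_congr rfl fun k _ => ?_
        rw [Finset.mul_sum]
    _ = _ := by simp [h, pow_two]

theorem transpose_mem_orthogonalGroup {U : Matrix (Fin N) (Fin N) ℝ}
    (hU : U ∈ Matrix.orthogonalGroup (Fin N) ℝ) :
    U.transpose ∈ Matrix.orthogonalGroup (Fin N) ℝ :=
  (Matrix.mem_orthogonalGroup_iff (Fin N) ℝ).2 (transpose_mul_of_mem hU)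

theorem mulMat_mul_transpose {U : Matrix (Fin N) (Fin N) ℝ}
    (hU : U ∈ Matrix.orthogonalGroup (Fin N) ℝ) (Φ : Fin N → V) :
    mulMat (mulMat Φ U) U.transpose = Φ := by
  rw [mulMat_mulMat, mul_transpose_of_mem hU, mulMat_one]

theorem abs_entry_le_one {U : Matrix (Fin N) (Fin N) ℝ}
    (hU : U ∈ Matrix.orthogonalGroup (Fin N) ℝ) (i j : Fin N) : |U i j| ≤ 1 := by
  have h := congrFun (congrFun (transpose_mul_of_mem hU) j) j
  rw [Matrix.mul_apply, Matrix.one_apply_eq] at h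
  have h1 : U i j ^ 2 ≤ 1 := by
    rw [← h]
    have := Finset.single_le_sum (f := fun k => U.transpose j k * U k j)
      (fun k _ => by simpa using mul_self_nonneg (U k j)) (Finset.mem_univ i)
    simpa [pow_two] using this
  exact (sq_le_one_iff_abs_le_one _).1 h1

theorem norm_mulMat_le (X : Fin N → V) (M : Matrix (Fin N) (Fin N) ℝ) {c : ℝ}
    (hM : ∀ i j, |M i j| ≤ c) : ‖mulMat X M‖ ≤ N * (c * ‖X‖) := by
  rcases isEmpty_or_nonempty (Fin N) with h | h
  · rw [Subsingleton.elim (mulMat X M) 0, Subsingleton.elim X 0]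
    simp
  have hc : 0 ≤ c := (abs_nonneg _).trans (hM (Classical.arbitrary _) (Classical.arbitrary _))
  rw [pi_norm_le_iff_of_nonneg (by positivity)]
  intro j
  calc ‖mulMat X M j‖ ≤ ∑ i, ‖M i j • X i‖ := norm_sum_le _ _
    _ ≤ ∑ _i : Fin N, c * ‖X‖ := by
        refine Finset.sum_le_sum fun i _ => ?_
        rw [norm_smul, Real.norm_eq_abs]
        gcongr
        · exact hM i j
        · exact norm_le_pi_norm X i
    _ = _ := by simp

theorem gram_mulMat (ι : V →L[ℝ] H) (Φ Ψ : Fin N → V) (M M' : Matrix (Fin N) (Fin N) ℝ) :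
    gram ι (mulMat Φ M) (mulMat Ψ M') = M.transpose * gram ι Φ Ψ * M' := by
  ext i j
  simp only [gram, mulMat, Matrix.of_apply, map_sum, map_smul, sum_inner, inner_sum,
    inner_smul_left, inner_smul_right, Matrix.mul_apply, Matrix.transpose_apply, Finset.sum_mul]
  refine Finset.sum_congr rfl fun k _ => ?_
  rw [Finset.mul_sum]
  refine Finset.sum_congr rfl fun l _ => ?_
  simp
  ring

theorem mulMat_mem_stiefel {ι : V →L[ℝ] H} {Φ : Fin N → V} (hΦ : Φ ∈ stiefel ι N)
    {U : Matrix (Fin N) (Fin N) ℝ} (hU : U ∈ Matrix.orthogonalGroup (Fin N) ℝ) :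
    mulMat Φ U ∈ stiefel ι N := by
  show gram ι _ _ = 1
  rw [gram_mulMat, (hΦ : gram ι Φ Φ = 1), mul_one, transpose_mul_of_mem hU]

/-- The projector `D_Φ` depends only on the point `[Φ]` of the Grassmann manifold. -/
theorem projDual_mulMat (Φ : Fin N → V) {U : Matrix (Fin N) (Fin N) ℝ}
    (hU : U ∈ Matrix.orthogonalGroup (Fin N) ℝ) : projDual (mulMat Φ U) = projDual Φ := by
  ext f
  simp only [projDual_apply]
  have h := sum_row_mul_row hU
  calc ∑ j, f (mulMat Φ U j) • mulMat Φ U j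
      = ∑ j, ∑ i, ∑ k, (U i j * U k j) • f (Φ i) • Φ k := by
        refine Finset.sum_congr rfl fun j _ => ?_
        simp only [mulMat, map_sum, map_smul, Finset.sum_smul, Finset.smul_sum]
        rw [Finset.sum_comm]
        refine Finset.sum_congr rfl fun i _ => Finset.sum_congr rfl fun k _ => ?_
        simp only [smul_smul, smul_eq_mul]
        congr 1
        ring
    _ = ∑ i, ∑ k, (∑ j, U i j * U k j) • f (Φ i) • Φ k := by
        rw [Finset.sum_comm]
        refine Finset.sum_congr rfl fun i _ => ?_
        rw [Finset.sum_comm]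
        refine Finset.sum_congr rfl fun k _ => ?_
        rw [Finset.sum_smul]
    _ = _ := by simp [h]

theorem compl_mulMat (ι : V →L[ℝ] H) (Φ : Fin N → V) {U : Matrix (Fin N) (Fin N) ℝ}
    (hU : U ∈ Matrix.orthogonalGroup (Fin N) ℝ) : compl ι (mulMat Φ U) = compl ι Φ := by
  simp only [compl, proj, projDual_mulMat Φ hU]

/-! ### Orthonormalization -/

theorem exists_posSemidef_mul_self {P : Matrix (Fin N) (Fin N) ℝ} (hP : P.PosSemidef) :
    ∃ S : Matrix (Fin N) (Fin N) ℝ, S.PosSemidef ∧ S.transpose = S ∧ S * S = P := by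
  obtain ⟨S, hS, hSS⟩ : ∃ S : Matrix (Fin N) (Fin N) ℝ, S.PosSemidef ∧ S * S = P := by
    open scoped MatrixOrder Matrix.Norms.L2Operator in
    exact ⟨CFC.sqrt P, Matrix.nonneg_iff_posSemidef.1 (CFC.sqrt_nonneg _),
      CFC.sqrt_mul_sqrt_self _ (Matrix.nonneg_iff_posSemidef.2 hP)⟩
  have hSt := hS.1.eq
  rw [Matrix.conjTranspose_eq_transpose_of_trivial] at hSt
  exact ⟨S, hS, hSt, hSS⟩

/-- Right multiplication by `K` changes the energy at most by the square of the spectral norm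
of `K`. -/
theorem energy_mulMat_le {T : V →L[ℝ] StrongDual ℝ V} (hT : IsPreconditioner T)
    (X : Fin N → V) (K : Matrix (Fin N) (Fin N) ℝ) {c : ℝ}
    (hK : ∀ x : Fin N → ℝ, ∑ j, (∑ i, x i * K i j) ^ 2 ≤ c * ∑ i, x i ^ 2) :
    energy T (mulMat X K) ≤ c * energy T X := by
  obtain ⟨hs, ϑ, Θ, hϑ, h⟩ := hT
  have hpsd : (Matrix.of fun i k => T (X i) (X k)).PosSemidef := by
    refine Matrix.PosSemidef.of_dotProduct_mulVec_nonneg ?_ fun x => ?_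
    · ext i k
      simp [hs (X k) (X i)]
    · have h1 : 0 ≤ T (∑ i, x i • X i) (∑ i, x i • X i) := le_trans (by positivity) (h _).1
      refine h1.trans (le_of_eq ?_)
      simp only [map_sum, map_smul, sum_apply, smul_apply, smul_eq_mul, dotProduct,
        Matrix.mulVec, Matrix.of_apply, star_trivial, Finset.mul_sum]
      rw [Finset.sum_comm]
      refine Finset.sum_congr rfl fun i _ => Finset.sum_congr rfl fun k _ => ?_
      ring
  obtain ⟨C, -, hCt, hC⟩ := exists_posSemidef_mul_self hpsd
  have hC' : ∀ i k, T (X i) (X k) = ∑ l, C l i * C l k := by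
    intro i k
    have hCC : C.transpose * C = Matrix.of fun i k => T (X i) (X k) := by rw [hCt, hC]
    simpa [Matrix.mul_apply] using (congrFun (congrFun hCC i) k).symm
  have e1 : energy T X = ∑ l, ∑ i, C l i ^ 2 := by
    rw [Finset.sum_comm]
    simp only [energy, hC', pow_two]
  have e2 : energy T (mulMat X K) = ∑ l, ∑ j, (∑ i, C l i * K i j) ^ 2 := by
    rw [Finset.sum_comm]
    refine Finset.sum_congr rfl fun j _ => ?_
    simp only [mulMat, map_sum, map_smul, sum_apply, smul_apply, smul_eq_mul, hC', pow_two,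
      Finset.sum_mul, Finset.mul_sum]
    rw [Finset.sum_comm]
    conv_rhs => rw [Finset.sum_comm]
    refine Finset.sum_congr rfl fun i _ => ?_
    rw [Finset.sum_comm]
    refine Finset.sum_congr rfl fun l _ => Finset.sum_congr rfl fun k _ => ?_
    ring
  rw [e1, e2, Finset.mul_sum]
  exact Finset.sum_le_sum fun l _ => hK (C l)

theorem energy_mulMat {T : V →L[ℝ] StrongDual ℝ V} (hT : IsPreconditioner T)
    (X : Fin N → V) {U : Matrix (Fin N) (Fin N) ℝ} (hU : U ∈ Matrix.orthogonalGroup (Fin N) ℝ) :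
    energy T (mulMat X U) = energy T X := by
  have key : ∀ (X : Fin N → V) {U : Matrix (Fin N) (Fin N) ℝ},
      U ∈ Matrix.orthogonalGroup (Fin N) ℝ → energy T (mulMat X U) ≤ energy T X := by
    intro X U hU
    have := energy_mulMat_le hT X U (c := 1) fun x => ?_
    · simpa using this
    rw [sum_sq_sum_mul hU, one_mul]
  refine le_antisymm (key X hU) ?_
  conv_lhs => rw [← mulMat_mul_transpose hU X]
  exact key _ (transpose_mem_orthogonalGroup hU)

theorem norm_sq_sum_smul {ι : V →L[ℝ] H} {Φ : Fin N → V} (hΦ : Φ ∈ stiefel ι N)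
    (x : Fin N → ℝ) : ‖ι (∑ i, x i • Φ i)‖ ^ 2 = ∑ i, x i ^ 2 := by
  rw [← real_inner_self_eq_norm_sq]
  simp only [map_sum, map_smul, sum_inner, inner_sum, inner_smul_left, inner_smul_right,
    inner_of_mem_stiefel hΦ]
  simp [pow_two]

theorem linearIndependent_of_lower_bound {ι : V →L[ℝ] H} {Φ : Fin N → V} {c : ℝ} (hc : 0 < c)
    (h : ∀ x : Fin N → ℝ, c * ∑ i, x i ^ 2 ≤ ‖ι (∑ i, x i • Φ i)‖ ^ 2) :
    LinearIndependent ℝ Φ := by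
  rw [Fintype.linearIndependent_iff]
  intro x hx i
  have h1 := h x
  rw [hx] at h1
  have h2 : ∑ i, x i ^ 2 ≤ 0 := by
    by_contra hlt
    push Not at hlt
    have : 0 < c * ∑ i, x i ^ 2 := by positivity
    simp at h1
    linarith
  have h3 := Finset.single_le_sum (f := fun i => x i ^ 2) (fun j _ => sq_nonneg _)
    (Finset.mem_univ i)
  have h4 : x i ^ 2 = 0 := le_antisymm (h3.trans h2) (sq_nonneg _)
  exact pow_eq_zero_iff (two_ne_zero) |>.1 h4

/-- Orthonormalizing a nearly orthonormal family increases the energy of its image under a linear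
map `f` at most by a factor close to `1`. -/
theorem energy_orthonormalization_le {T : V →L[ℝ] StrongDual ℝ V} (hT : IsPreconditioner T)
    {ι : V →L[ℝ] H} {Φ Φ' : Fin N → V} {c : ℝ} (hc : 0 < c)
    (h : ∀ x : Fin N → ℝ, c * ∑ i, x i ^ 2 ≤ ‖ι (∑ i, x i • Φ i)‖ ^ 2)
    (hΦ' : Φ' ∈ stiefel ι N)
    (hspan : Submodule.span ℝ (Set.range Φ') = Submodule.span ℝ (Set.range Φ))
    (f : V →L[ℝ] V) :
    energy T (fun i => f (Φ' i)) ≤ c⁻¹ * energy T (fun i => f (Φ i)) := by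
  have hmem : ∀ j, ∃ k : Fin N → ℝ, ∑ i, k i • Φ i = Φ' j := fun j => by
    rw [← Submodule.mem_span_range_iff_exists_fun, ← hspan]
    exact Submodule.subset_span ⟨j, rfl⟩
  choose k hk using hmem
  let K : Matrix (Fin N) (Fin N) ℝ := Matrix.of fun i j => k j i
  have hΦK : (fun j => f (Φ' j)) = mulMat (fun i => f (Φ i)) K := by
    ext j
    simp [← hk j, mulMat, K]
  rw [hΦK]
  refine energy_mulMat_le hT _ K fun x => ?_
  set y : Fin N → ℝ := fun j => ∑ i, x i * K i j with hy
  set z : Fin N → ℝ := fun i => ∑ j, y j * K i j with hz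
  have h1 : c * ∑ i, z i ^ 2 ≤ ∑ j, y j ^ 2 := by
    have e : ∑ i, z i • Φ i = ∑ j, y j • Φ' j := by
      simp only [hz, ← hk, Finset.sum_smul, Finset.smul_sum, smul_smul, K, Matrix.of_apply]
      exact Finset.sum_comm
    have := h z
    rwa [e, norm_sq_sum_smul hΦ'] at this
  have h2 : ∑ j, y j ^ 2 = ∑ i, x i * z i := by
    simp only [hz, Finset.mul_sum]
    rw [Finset.sum_comm]
    refine Finset.sum_congr rfl fun j _ => ?_
    rw [pow_two]
    conv_lhs => rw [hy]
    simp only [Finset.sum_mul]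
    refine Finset.sum_congr rfl fun i _ => ?_
    simp only [hy]
    ring
  have h3 : (∑ j, y j ^ 2) ^ 2 ≤ (∑ i, x i ^ 2) * ∑ i, z i ^ 2 := by
    rw [h2]; exact Finset.sum_mul_sq_le_sq_mul_sq _ _ _
  have hx0 : 0 ≤ ∑ i, x i ^ 2 := by positivity
  have hy0 : 0 ≤ ∑ j, y j ^ 2 := by positivity
  rw [le_inv_mul_iff₀ hc]
  rcases hy0.eq_or_lt with h0 | h0
  · rw [← h0]; simpa using hx0
  · refine le_of_mul_le_mul_right ?_ h0
    calc c * (∑ j, y j ^ 2) * ∑ j, y j ^ 2 = c * (∑ j, y j ^ 2) ^ 2 := by ring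
      _ ≤ c * ((∑ i, x i ^ 2) * ∑ i, z i ^ 2) := by gcongr
      _ = (∑ i, x i ^ 2) * (c * ∑ i, z i ^ 2) := by ring
      _ ≤ _ := by gcongr

open Filter Topology in
/-- Near an orthonormal family the Gram matrix is close to the identity. -/
theorem eventually_lower_bound {ι : V →L[ℝ] H} {Ψ : Fin N → V} (hΨ : Ψ ∈ stiefel ι N)
    {c : ℝ} (hc : c < 1) : ∀ᶠ Φ in 𝓝 Ψ, ∀ x : Fin N → ℝ,
      c * ∑ i, x i ^ 2 ≤ ‖ι (∑ i, x i • Φ i)‖ ^ 2 := by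
  set δ : ℝ := (1 - c) / (N + 1) with hδ
  have hδ0 : 0 < δ := by
    have : 0 < 1 - c := by linarith
    positivity
  have hev : ∀ᶠ Φ in 𝓝 Ψ, ∀ i j,
      |inner ℝ (ι (Φ i)) (ι (Φ j)) - inner ℝ (ι (Ψ i)) (ι (Ψ j))| < δ := by
    rw [eventually_all]; intro i
    rw [eventually_all]; intro j
    have hcont : Continuous fun Φ : Fin N → V => (inner ℝ (ι (Φ i)) (ι (Φ j)) : ℝ) := by fun_prop
    simpa [Real.dist_eq] using Metric.tendsto_nhds.1 (hcont.tendsto Ψ) δ hδ0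
  filter_upwards [hev] with Φ hΦ x
  have e1 : ‖ι (∑ i, x i • Φ i)‖ ^ 2 = ∑ i, ∑ j, x i * x j * inner ℝ (ι (Φ i)) (ι (Φ j)) := by
    rw [← real_inner_self_eq_norm_sq]
    simp only [map_sum, map_smul, sum_inner, inner_sum, inner_smul_left, inner_smul_right]
    refine Finset.sum_congr rfl fun i _ => ?_
    rw [Finset.mul_sum]
    refine Finset.sum_congr rfl fun j _ => ?_
    simp only [conj_trivial, real_inner_comm (ι (Φ i))]
    ring
  have e2 : ∑ i, x i ^ 2 = ∑ i, ∑ j, x i * x j * inner ℝ (ι (Ψ i)) (ι (Ψ j)) := by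
    simp [inner_of_mem_stiefel hΨ, pow_two]
  have h1 : ∑ i, x i ^ 2 - ‖ι (∑ i, x i • Φ i)‖ ^ 2 ≤ ∑ i, ∑ j, |x i| * |x j| * δ := by
    rw [e1, e2, ← Finset.sum_sub_distrib]
    refine Finset.sum_le_sum fun i _ => ?_
    rw [← Finset.sum_sub_distrib]
    refine Finset.sum_le_sum fun j _ => ?_
    rw [← mul_sub]
    refine (le_abs_self _).trans ?_
    rw [abs_mul, abs_mul, abs_sub_comm]
    gcongr
    exact (hΦ i j).le
  have h2 : ∑ i, ∑ j, |x i| * |x j| * δ = δ * (∑ i, |x i|) ^ 2 := by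
    rw [pow_two, Finset.sum_mul_sum, Finset.mul_sum]
    refine Finset.sum_congr rfl fun i _ => ?_
    rw [Finset.mul_sum]
    exact Finset.sum_congr rfl fun j _ => by ring
  have h3 : (∑ i, |x i|) ^ 2 ≤ N * ∑ i, x i ^ 2 := by
    have := sq_sum_le_card_mul_sum_sq (s := (Finset.univ : Finset (Fin N))) (f := fun i => |x i|)
    simpa using this
  have hx0 : 0 ≤ ∑ i, x i ^ 2 := by positivity
  have h4 : δ * (∑ i, |x i|) ^ 2 ≤ (1 - c) * ∑ i, x i ^ 2 := by
    calc δ * (∑ i, |x i|) ^ 2 ≤ δ * (N * ∑ i, x i ^ 2) := by gcongr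
      _ ≤ δ * ((N + 1) * ∑ i, x i ^ 2) := by gcongr; linarith
      _ = _ := by rw [hδ]; field_simp
  linarith

/-! ### Alignment of nearby families by polar decomposition -/

/-- For a positive semidefinite `S`, the columns of `S - 1` are dominated by those of `S² - 1`:
expand `(S² - 1)ᵀ (S² - 1) = (S - 1)ᵀ (S + 1)² (S - 1)`. -/
theorem abs_sub_one_entry_le {S : Matrix (Fin N) (Fin N) ℝ} (hS : S.PosSemidef) {g : ℝ}
    (hg : ∀ i j, |(1 - S * S) i j| ≤ g) (k l : Fin N) : |(S - 1) k l| ≤ N * g := by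
  have hg0 : 0 ≤ g := (abs_nonneg _).trans (hg k l)
  have hSt : S.transpose = S := by
    have := hS.1.eq
    rwa [Matrix.conjTranspose_eq_transpose_of_trivial] at this
  have hexp : (1 - S * S).transpose * (1 - S * S) =
      (S - 1).transpose * (S - 1) + ((S * (S - 1)).transpose * (S * (S - 1))
        + ((S - 1).transpose * S * (S - 1) + (S - 1).transpose * S * (S - 1))) := by
    simp only [Matrix.transpose_sub, Matrix.transpose_mul, Matrix.transpose_one, hSt]
    noncomm_ring
  have h1 : ∀ A : Matrix (Fin N) (Fin N) ℝ, (A.transpose * A) l l = ∑ i, A i l ^ 2 := by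
    intro A
    simp [Matrix.mul_apply, pow_two]
  have h2 : 0 ≤ ((S - 1).transpose * S * (S - 1)) l l := by
    have := (hS.conjTranspose_mul_mul_same (S - 1)).diag_nonneg (i := l)
    rwa [Matrix.conjTranspose_eq_transpose_of_trivial] at this
  have h3 := congrFun (congrFun hexp l) l
  simp only [Matrix.add_apply, h1] at h3
  have h4 : 0 ≤ ∑ i, (S * (S - 1)) i l ^ 2 := by positivity
  have h5 := Finset.single_le_sum (f := fun i => (S - 1) i l ^ 2) (fun i _ => sq_nonneg _)
    (Finset.mem_univ k)
  have h6 : ∑ i, (1 - S * S) i l ^ 2 ≤ N * g ^ 2 := by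
    calc ∑ i, (1 - S * S) i l ^ 2 ≤ ∑ _i : Fin N, g ^ 2 := by
          refine Finset.sum_le_sum fun i _ => ?_
          rw [← sq_abs]
          exact pow_le_pow_left₀ (abs_nonneg _) (hg i l) 2
      _ = _ := by simp
  have hN : (1 : ℝ) ≤ N := by
    have : 0 < N := Fin.pos k
    exact_mod_cast this
  apply abs_le_of_sq_le_sq _ (by positivity)
  calc (S - 1) k l ^ 2 ≤ N * g ^ 2 := by linarith
    _ ≤ N * (N * g ^ 2) := le_mul_of_one_le_left (by positivity) hN
    _ = _ := by ring

/-- A matrix that is nearly orthogonal can be rotated near the identity, with an error controlled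
by the defect of orthogonality: the rotation is the orthogonal factor of the polar
decomposition. -/
theorem exists_orthogonal_mul_near_one (M : Matrix (Fin N) (Fin N) ℝ) {g : ℝ}
    (hg : ∀ i j, |(1 - M.transpose * M) i j| ≤ g) (hN : N * g < 1) :
    ∃ U ∈ Matrix.orthogonalGroup (Fin N) ℝ, ∀ i j, |(M * U - 1) i j| ≤ N ^ 3 * g := by
  have hpsd : (M.transpose * M).PosSemidef := by
    have := Matrix.posSemidef_conjTranspose_mul_self M
    rwa [Matrix.conjTranspose_eq_transpose_of_trivial] at this
  obtain ⟨S, hS, hSt, hSS⟩ := exists_posSemidef_mul_self hpsd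
  -- `MᵀM` is strictly diagonally dominant
  have hdet : (M.transpose * M).det ≠ 0 := by
    apply det_ne_zero_of_sum_row_lt_diag
    intro k
    have hoff : ∀ j ∈ Finset.univ.erase k, ‖(M.transpose * M) k j‖ ≤ g := by
      intro j hj
      have := hg k j
      rw [Matrix.sub_apply, Matrix.one_apply_ne (Finset.ne_of_mem_erase hj).symm, zero_sub,
        abs_neg] at this
      exact this
    have hdiag : 1 - g ≤ ‖(M.transpose * M) k k‖ := by
      have := hg k k
      rw [Matrix.sub_apply, Matrix.one_apply_eq] at this
      have h1 := (le_abs_self _).trans this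
      have h2 := le_abs_self ((M.transpose * M) k k)
      rw [Real.norm_eq_abs]
      linarith
    have hcard : ((Finset.univ.erase k).card : ℝ) = N - 1 := by
      rw [Finset.card_erase_of_mem (Finset.mem_univ k), Finset.card_univ, Fintype.card_fin,
        Nat.cast_sub (Fin.pos k)]
      simp
    calc ∑ j ∈ Finset.univ.erase k, ‖(M.transpose * M) k j‖
        ≤ ∑ _j ∈ Finset.univ.erase k, g := Finset.sum_le_sum hoff
      _ = (N - 1) * g := by rw [Finset.sum_const, nsmul_eq_mul, hcard]
      _ < 1 - g := by linarith
      _ ≤ _ := hdiag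
  have hSdet : IsUnit S.det := by
    rw [← hSS, Matrix.det_mul] at hdet
    exact isUnit_iff_ne_zero.2 (left_ne_zero_of_mul hdet)
  set U : Matrix (Fin N) (Fin N) ℝ := S⁻¹ * M.transpose with hU
  have hUt : U.transpose = M * S⁻¹ := by
    rw [hU, Matrix.transpose_mul, Matrix.transpose_transpose, Matrix.transpose_nonsing_inv, hSt]
  have hUmem : U ∈ Matrix.orthogonalGroup (Fin N) ℝ := by
    refine (Matrix.mem_orthogonalGroup_iff (Fin N) ℝ).2 ?_
    change U * U.transpose = 1
    calc U * U.transpose = S⁻¹ * (M.transpose * M) * S⁻¹ := by rw [hUt, hU]; noncomm_ring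
      _ = (S⁻¹ * S) * (S * S⁻¹) := by rw [← hSS]; noncomm_ring
      _ = 1 := by rw [Matrix.nonsing_inv_mul _ hSdet, Matrix.mul_nonsing_inv _ hSdet, one_mul]
  refine ⟨U, hUmem, fun i j => ?_⟩
  have hM : M = U.transpose * S := by
    rw [hUt, Matrix.mul_assoc, Matrix.nonsing_inv_mul _ hSdet, Matrix.mul_one]
  have hMU : M * U - 1 = U.transpose * (S - 1) * U := by
    rw [Matrix.mul_sub, Matrix.sub_mul, ← hM, Matrix.mul_one, transpose_mul_of_mem hUmem]
  rw [hMU, Matrix.mul_apply]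
  simp only [Matrix.mul_apply (M := U.transpose), Matrix.transpose_apply, Finset.sum_mul]
  have hterm : ∀ l k, |U k i * (S - 1) k l * U l j| ≤ N * g := by
    intro l k
    rw [abs_mul, abs_mul]
    have hb := abs_sub_one_entry_le hS (by rwa [hSS]) k l
    calc |U k i| * |(S - 1) k l| * |U l j| ≤ 1 * (N * g) * 1 := by
          gcongr
          · rw [one_mul]; exact (abs_nonneg _).trans hb
          · exact abs_entry_le_one hUmem k i
          · exact abs_entry_le_one hUmem l j
      _ = _ := by ring
  calc |∑ l, ∑ k, U k i * (S - 1) k l * U l j|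
      ≤ ∑ l, ∑ k, |U k i * (S - 1) k l * U l j| :=
        (Finset.abs_sum_le_sum_abs _ _).trans
          (Finset.sum_le_sum fun l _ => Finset.abs_sum_le_sum_abs _ _)
    _ ≤ ∑ _l : Fin N, ∑ _k : Fin N, (N * g) :=
        Finset.sum_le_sum fun l _ => Finset.sum_le_sum fun k _ => hterm l k
    _ = _ := by simp; ring

/-- The component `(I - D_Ψ) Φ` of a family. -/
def normalPart (ι : V →L[ℝ] H) (Ψ : Fin N → V) : (Fin N → V) →L[ℝ] (Fin N → V) :=
  ContinuousLinearMap.pi fun i => (compl ι Ψ).comp (ContinuousLinearMap.proj i)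

theorem normalPart_apply (ι : V →L[ℝ] H) (Ψ Φ : Fin N → V) (i : Fin N) :
    normalPart ι Ψ Φ i = compl ι Ψ (Φ i) := rfl

theorem normalPart_mem_tangent {ι : V →L[ℝ] H} {Ψ : Fin N → V} (hΨ : Ψ ∈ stiefel ι N)
    (Φ : Fin N → V) : normalPart ι Ψ Φ ∈ tangent ι Ψ :=
  mem_tangent_iff.2 fun i j => inner_compl hΨ (Φ i) j

theorem normalPart_self {ι : V →L[ℝ] H} {Ψ : Fin N → V} (hΨ : Ψ ∈ stiefel ι N) :
    normalPart ι Ψ Ψ = 0 := by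
  ext i
  exact compl_basis hΨ i

theorem normalPart_mulMat (ι : V →L[ℝ] H) (Ψ Φ : Fin N → V) (M : Matrix (Fin N) (Fin N) ℝ) :
    normalPart ι Ψ (mulMat Φ M) = mulMat (normalPart ι Ψ Φ) M := by
  ext j
  simp [normalPart_apply, mulMat]

theorem eq_mulMat_gram_add (ι : V →L[ℝ] H) (Ψ Φ : Fin N → V) :
    Φ = mulMat Ψ (gram ι Ψ Φ) + normalPart ι Ψ Φ := by
  ext j
  simp [normalPart_apply, compl_apply, proj_apply, mulMat, gram, real_inner_comm]

/-- The orthonormal families whose representative is aligned with `Ψ`, in the sense that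
`Φ - Ψ` and the normal part `(I - D) Φ` agree up to second order. -/
def aligned (ι : V →L[ℝ] H) (Ψ : Fin N → V) (C : ℝ) : Set (Fin N → V) :=
  {Φ | Φ ∈ stiefel ι N ∧ ‖Φ - Ψ - normalPart ι Ψ Φ‖ ≤ C * ‖normalPart ι Ψ Φ‖ ^ 2}

theorem abs_one_sub_gram_le {ι : V →L[ℝ] H} {Ψ Φ : Fin N → V} (hΨ : Ψ ∈ stiefel ι N)
    (hΦ : Φ ∈ stiefel ι N) (i j : Fin N) :
    |(1 - (gram ι Ψ Φ).transpose * gram ι Ψ Φ) i j| ≤ ‖ι‖ ^ 2 * ‖normalPart ι Ψ Φ‖ ^ 2 := by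
  set E := normalPart ι Ψ Φ with hE
  have h1 : (1 - (gram ι Ψ Φ).transpose * gram ι Ψ Φ) i j = inner ℝ (ι (E i)) (ι (E j)) := by
    have hEj : ∀ j, E j = Φ j - ∑ k, gram ι Ψ Φ k j • Ψ k := by
      intro j
      have := congrFun (eq_mulMat_gram_add ι Ψ Φ) j
      rw [Pi.add_apply] at this
      exact eq_sub_of_add_eq' this.symm
    have hEi : ∀ k, inner ℝ (ι (E i)) (ι (Ψ k)) = (0 : ℝ) := fun k => inner_compl hΨ (Φ i) k
    have e1 : inner ℝ (ι (E i)) (ι (E j)) = (inner ℝ (ι (E i)) (ι (Φ j)) : ℝ) := by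
      rw [hEj j]
      simp [inner_sub_right, inner_sum, inner_smul_right, hEi]
    rw [e1, hEj i]
    simp [inner_sub_left, sum_inner, inner_smul_left, inner_of_mem_stiefel hΦ,
      Matrix.one_apply, Matrix.mul_apply, gram]
  rw [h1]
  calc |inner ℝ (ι (E i)) (ι (E j))| ≤ ‖ι (E i)‖ * ‖ι (E j)‖ := abs_real_inner_le_norm _ _
    _ ≤ (‖ι‖ * ‖E‖) * (‖ι‖ * ‖E‖) := by
        gcongr
        · exact (ι.le_opNorm _).trans (by gcongr; exact norm_le_pi_norm E i)
        · exact (ι.le_opNorm _).trans (by gcongr; exact norm_le_pi_norm E j)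
    _ = _ := by ring

open Filter Topology in
/-- Every orthonormal family with a small normal part can be rotated into a given relative
neighbourhood of `Ψ` in the aligned families. -/
theorem exists_aligned {ι : V →L[ℝ] H} {Ψ : Fin N → V} (hΨ : Ψ ∈ stiefel ι N) :
    ∃ C : ℝ, ∀ p : (Fin N → V) → Prop, (∀ᶠ Φ in 𝓝[aligned ι Ψ C] Ψ, p Φ) →
      ∃ ε : ℝ, 0 < ε ∧ ∀ Φ ∈ stiefel ι N, ‖normalPart ι Ψ Φ‖ < ε →
        ∃ U ∈ Matrix.orthogonalGroup (Fin N) ℝ,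
          mulMat Φ U ∈ stiefel ι N ∧ p (mulMat Φ U) := by
  set C₁ : ℝ := N * (N ^ 3 * (‖ι‖ ^ 2) * ‖Ψ‖) with hC₁
  have hC₁0 : 0 ≤ C₁ := by positivity
  -- the factor `N ^ 2` pays for comparing the sup norms of the normal parts of `Φ` and `Φ U`
  refine ⟨C₁ * N ^ 2, fun p hp => ?_⟩
  rw [eventually_nhdsWithin_iff, Metric.eventually_nhds_iff] at hp
  obtain ⟨r, hr, hp⟩ := hp
  have hlim : Tendsto (fun e : ℝ => N * e + C₁ * e ^ 2) (𝓝 0) (𝓝 0) := by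
    have : Continuous (fun e : ℝ => N * e + C₁ * e ^ 2) := by fun_prop
    simpa using this.tendsto 0
  have hlim2 : Tendsto (fun e : ℝ => N * (‖ι‖ ^ 2 * e ^ 2)) (𝓝 0) (𝓝 0) := by
    have : Continuous (fun e : ℝ => N * (‖ι‖ ^ 2 * e ^ 2)) := by fun_prop
    simpa using this.tendsto 0
  obtain ⟨ε, hε, hball⟩ := Metric.eventually_nhds_iff.1
    ((hlim.eventually_lt_const hr).and (hlim2.eventually_lt_const one_pos))
  refine ⟨ε, hε, fun Φ hΦ hE => ?_⟩
  set e := ‖normalPart ι Ψ Φ‖ with he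
  have he' := hball (y := e) (by simpa [he] using hE)
  obtain ⟨U, hU, hMU⟩ := exists_orthogonal_mul_near_one (gram ι Ψ Φ)
    (g := ‖ι‖ ^ 2 * e ^ 2) (abs_one_sub_gram_le hΨ hΦ) he'.2
  have hmem := mulMat_mem_stiefel hΦ hU
  have hdecomp : mulMat Φ U - Ψ - normalPart ι Ψ (mulMat Φ U) =
      mulMat Ψ (gram ι Ψ Φ * U - 1) := by
    have h1 : gram ι Ψ (mulMat Φ U) = gram ι Ψ Φ * U := by
      have := gram_mulMat ι Ψ Φ 1 U
      simpa using this
    have h2 := eq_mulMat_gram_add ι Ψ (mulMat Φ U)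
    rw [h1] at h2
    have h3 : mulMat Ψ (gram ι Ψ Φ * U - 1) = mulMat Ψ (gram ι Ψ Φ * U) - Ψ := by
      ext j
      simp [mulMat, sub_smul, Finset.sum_sub_distrib, Matrix.one_apply]
    rw [h3, sub_right_comm, ← eq_sub_of_add_eq h2.symm]
  have hnorm1 : ‖mulMat Φ U - Ψ - normalPart ι Ψ (mulMat Φ U)‖ ≤ C₁ * e ^ 2 := by
    rw [hdecomp]
    refine (norm_mulMat_le _ _ hMU).trans (le_of_eq ?_)
    rw [hC₁]; ring
  have hnorm2 : ‖normalPart ι Ψ (mulMat Φ U)‖ ≤ N * e := by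
    rw [normalPart_mulMat]
    refine (norm_mulMat_le _ _ (abs_entry_le_one hU)).trans (le_of_eq ?_)
    rw [one_mul]
  have hnorm3 : e ≤ N * ‖normalPart ι Ψ (mulMat Φ U)‖ := by
    have h1 : normalPart ι Ψ Φ = mulMat (normalPart ι Ψ (mulMat Φ U)) U.transpose := by
      rw [← normalPart_mulMat, mulMat_mul_transpose hU]
    rw [he]
    conv_lhs => rw [h1]
    refine (norm_mulMat_le _ _ (abs_entry_le_one (transpose_mem_orthogonalGroup hU))).trans
      (le_of_eq ?_)
    rw [one_mul]
  refine ⟨U, hU, hmem, hp ?_ ⟨hmem, hnorm1.trans ?_⟩⟩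
  · rw [dist_eq_norm]
    calc ‖mulMat Φ U - Ψ‖ = ‖normalPart ι Ψ (mulMat Φ U)
            + (mulMat Φ U - Ψ - normalPart ι Ψ (mulMat Φ U))‖ := by congr 1; abel
      _ ≤ N * e + C₁ * e ^ 2 := (norm_add_le _ _).trans (add_le_add hnorm2 hnorm1)
      _ < r := he'.1
  · have h0 : 0 ≤ e := norm_nonneg _
    calc C₁ * e ^ 2 ≤ C₁ * (N * ‖normalPart ι Ψ (mulMat Φ U)‖) ^ 2 := by gcongr
      _ = _ := by ring

/-! ### Rotations generated by antisymmetric operators -/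

theorem inner_exp_smul [CompleteSpace V] {ι : V →L[ℝ] H} {Y : V →L[ℝ] V}
    (hY : ∀ u v, inner ℝ (ι (Y u)) (ι v) = -(inner ℝ (ι u) (ι (Y v)) : ℝ)) (t : ℝ) (u v : V) :
    inner ℝ (ι (NormedSpace.exp (t • Y) u)) (ι (NormedSpace.exp (t • Y) v)) =
      (inner ℝ (ι u) (ι v) : ℝ) := by
  have hd : ∀ (w : V) (t : ℝ), HasDerivAt (fun t : ℝ => ι (NormedSpace.exp (t • Y) w))
      (ι (Y (NormedSpace.exp (t • Y) w))) t := by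
    intro w t
    have h1 : HasDerivAt (fun t : ℝ => NormedSpace.exp (t • Y)) (Y * NormedSpace.exp (t • Y)) t :=
      hasDerivAt_exp_smul_const' Y t
    have h2 := h1.clm_apply (hasDerivAt_const t w)
    have h3 := ι.hasFDerivAt.comp_hasDerivAt t h2
    simpa [Function.comp_def] using h3
  have hconst : ∀ t : ℝ, HasDerivAt (fun t : ℝ =>
      (inner ℝ (ι (NormedSpace.exp (t • Y) u)) (ι (NormedSpace.exp (t • Y) v)) : ℝ)) 0 t := by
    intro t
    have := (hd u t).inner ℝ (hd v t)
    rw [hY] at this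
    simpa using this
  have := is_const_of_deriv_eq_zero (fun t => (hconst t).differentiableAt)
    (fun t => (hconst t).deriv) t 0
  simpa using this

theorem exp_mem_stiefel [CompleteSpace V] {ι : V →L[ℝ] H} {Y : V →L[ℝ] V}
    (hY : ∀ u v, inner ℝ (ι (Y u)) (ι v) = -(inner ℝ (ι u) (ι (Y v)) : ℝ))
    {Φ : Fin N → V} (hΦ : Φ ∈ stiefel ι N) (t : ℝ) :
    (fun i => NormedSpace.exp (t • Y) (Φ i)) ∈ stiefel ι N := by
  show gram ι _ _ = 1
  rw [← (hΦ : gram ι Φ Φ = 1)]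
  ext i j
  exact inner_exp_smul hY t (Φ i) (Φ j)

/-- The `L₂`-antisymmetric operator `∑ i, (w_i ⊗ φ_i - φ_i ⊗ w_i)` of finite rank, which generates
the geodesic of the Grassmann manifold through `[Φ]` in the direction `W`. -/
def rotation (ι : V →L[ℝ] H) (Φ W : Fin N → V) : V →L[ℝ] V :=
  ∑ i, ((toDual ι (Φ i)).smulRight (W i) - (toDual ι (W i)).smulRight (Φ i))

theorem rotation_apply (ι : V →L[ℝ] H) (Φ W : Fin N → V) (v : V) :
    rotation ι Φ W v = ∑ i, ((inner ℝ (ι (Φ i)) (ι v) : ℝ) • W i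
      - (inner ℝ (ι (W i)) (ι v) : ℝ) • Φ i) := by
  simp [rotation]

theorem rotation_antisymm (ι : V →L[ℝ] H) (Φ W : Fin N → V) (u v : V) :
    inner ℝ (ι (rotation ι Φ W u)) (ι v) = -(inner ℝ (ι u) (ι (rotation ι Φ W v)) : ℝ) := by
  simp only [rotation_apply, map_sum, map_sub, map_smul, sum_inner, inner_sum, inner_sub_left,
    inner_sub_right, inner_smul_left, inner_smul_right, ← Finset.sum_neg_distrib]
  refine Finset.sum_congr rfl fun i _ => ?_
  simp only [conj_trivial, real_inner_comm (ι u)]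
  ring

theorem rotation_basis {ι : V →L[ℝ] H} {Φ W : Fin N → V} (hΦ : Φ ∈ stiefel ι N)
    (hW : W ∈ tangent ι Φ) (i : Fin N) : rotation ι Φ W (Φ i) = W i := by
  simp [rotation_apply, inner_of_mem_stiefel hΦ, mem_tangent_iff.1 hW]

theorem norm_rotation_le (ι : V →L[ℝ] H) (Φ W : Fin N → V) :
    ‖rotation ι Φ W‖ ≤ N * (2 * ‖toDual ι‖) * ‖Φ‖ * ‖W‖ := by
  calc ‖rotation ι Φ W‖ ≤ ∑ _i : Fin N, (2 * ‖toDual ι‖ * ‖Φ‖ * ‖W‖) := by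
        refine (norm_sum_le _ _).trans (Finset.sum_le_sum fun i _ => ?_)
        refine (norm_sub_le _ _).trans ?_
        rw [ContinuousLinearMap.norm_smulRight_apply, ContinuousLinearMap.norm_smulRight_apply]
        have h1 : ‖toDual ι (Φ i)‖ * ‖W i‖ ≤ (‖toDual ι‖ * ‖Φ‖) * ‖W‖ := by
          gcongr
          · exact ((toDual ι).le_opNorm _).trans (by gcongr; exact norm_le_pi_norm Φ i)
          · exact norm_le_pi_norm W i
        have h2 : ‖toDual ι (W i)‖ * ‖Φ i‖ ≤ (‖toDual ι‖ * ‖W‖) * ‖Φ‖ := by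
          gcongr
          · exact ((toDual ι).le_opNorm _).trans (by gcongr; exact norm_le_pi_norm W i)
          · exact norm_le_pi_norm Φ i
        nlinarith
    _ = _ := by simp; ring

/-! ### The gradient: first order condition and equivariance -/

theorem grad_apply (J : (Fin N → V) → ℝ) (Φ : Fin N → V) (i : Fin N) (v : V) :
    grad J Φ i v = fderiv ℝ J Φ (Pi.single i v) := rfl

/-- A minimizer satisfies the first order condition `(I - D) J'(Ψ) = 0`: differentiate `J` along
the geodesics through `Ψ`. -/
theorem complDual_grad_eq_zero [CompleteSpace V] {ι : V →L[ℝ] H} {J : (Fin N → V) → ℝ}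
    {Ψ : Fin N → V} (hΨ : Ψ ∈ stiefel ι N) (hmin : ∀ Φ ∈ stiefel ι N, J Ψ ≤ J Φ)
    (hJ : DifferentiableAt ℝ J Ψ) (i : Fin N) : complDual ι Ψ (grad J Ψ i) = 0 := by
  have hW : ∀ W ∈ tangent ι Ψ, fderiv ℝ J Ψ W = 0 := by
    intro W hW
    set Y := rotation ι Ψ W
    have hc : HasDerivAt (fun t : ℝ => fun i => NormedSpace.exp (t • Y) (Ψ i)) W 0 := by
      rw [hasDerivAt_pi]
      intro i
      have h1 : HasDerivAt (fun t : ℝ => NormedSpace.exp (t • Y))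
          (Y * NormedSpace.exp ((0 : ℝ) • Y)) 0 := hasDerivAt_exp_smul_const' Y 0
      have h2 := h1.clm_apply (hasDerivAt_const (0 : ℝ) (Ψ i))
      simpa [rotation_basis hΨ hW, Y] using h2
    have hc0 : (fun i => NormedSpace.exp ((0 : ℝ) • Y) (Ψ i)) = Ψ := by ext i; simp
    have hJ' : HasFDerivAt J (fderiv ℝ J Ψ) (fun i => NormedSpace.exp ((0 : ℝ) • Y) (Ψ i)) := by
      rw [hc0]; exact hJ.hasFDerivAt
    have hcomp := hJ'.comp_hasDerivAt (0 : ℝ) hc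
    refine IsLocalMin.hasDerivAt_eq_zero (Filter.Eventually.of_forall fun t => ?_) hcomp
    simp only [Function.comp_apply]
    rw [hc0]
    exact hmin _ (exp_mem_stiefel (rotation_antisymm ι Ψ W) hΨ t)
  ext v
  rw [complDual_apply_apply, grad_apply]
  refine hW _ (mem_tangent_iff.2 fun k j => ?_)
  by_cases hk : k = i
  · subst hk; simpa using inner_compl hΨ v j
  · simp [hk]

theorem fderiv_apply_eq_sum (J : (Fin N → V) → ℝ) (Φ W : Fin N → V) :
    fderiv ℝ J Φ W = ∑ i, grad J Φ i (W i) := by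
  simp only [grad_apply, ← map_sum]
  congr 1
  ext j
  simp [Finset.sum_apply, Pi.single_apply]

/-- Right multiplication by a matrix, as a continuous linear map on families. -/
def mulMatL (M : Matrix (Fin N) (Fin N) ℝ) : (Fin N → V) →L[ℝ] (Fin N → V) :=
  ContinuousLinearMap.pi fun j => ∑ i, M i j • ContinuousLinearMap.proj i

theorem mulMatL_apply (M : Matrix (Fin N) (Fin N) ℝ) (Φ : Fin N → V) :
    mulMatL M Φ = mulMat Φ M := by
  ext j
  simp [mulMatL, mulMat]

theorem grad_mulMat {J : (Fin N → V) → ℝ}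
    (hJinv : ∀ (Φ : Fin N → V), ∀ U ∈ Matrix.orthogonalGroup (Fin N) ℝ, J (mulMat Φ U) = J Φ)
    (Φ : Fin N → V) {U : Matrix (Fin N) (Fin N) ℝ}
    (hU : U ∈ Matrix.orthogonalGroup (Fin N) ℝ) (j : Fin N) :
    grad J (mulMat Φ U) j = ∑ i, U i j • grad J Φ i := by
  let e : (Fin N → V) ≃L[ℝ] (Fin N → V) :=
    ContinuousLinearEquiv.equivOfInverse (mulMatL U) (mulMatL U.transpose)
      (fun Φ => by rw [mulMatL_apply, mulMatL_apply, mulMat_mul_transpose hU])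
      (fun Φ => by
        rw [mulMatL_apply, mulMatL_apply]
        simpa using mulMat_mul_transpose (transpose_mem_orthogonalGroup hU) Φ)
  have he : ∀ Φ, e Φ = mulMat Φ U := fun Φ => mulMatL_apply U Φ
  have hJe : J ∘ e = J := by
    ext Φ
    rw [Function.comp_apply, he, hJinv Φ U hU]
  have hfd : fderiv ℝ J Φ = (fderiv ℝ J (mulMat Φ U)).comp (e : (Fin N → V) →L[ℝ] (Fin N → V)) := by
    have := e.comp_right_fderiv (f := J) (x := Φ)
    rwa [hJe, he] at this
  have hgrad : ∀ i v, grad J Φ i v = ∑ k, U i k * grad J (mulMat Φ U) k v := by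
    intro i v
    rw [grad_apply, hfd, ContinuousLinearMap.comp_apply, ContinuousLinearEquiv.coe_coe, he,
      fderiv_apply_eq_sum]
    refine Finset.sum_congr rfl fun k _ => ?_
    simp [mulMat, Pi.single_apply]
  have hrow : ∀ k, ∑ i, U i j * U i k = if j = k then (1 : ℝ) else 0 := fun k => by
    simpa using sum_row_mul_row (transpose_mem_orthogonalGroup hU) j k
  ext v
  simp only [sum_apply, smul_apply, smul_eq_mul, hgrad, Finset.mul_sum]
  rw [Finset.sum_comm]
  simp only [← mul_assoc, ← Finset.sum_mul, hrow]
  simp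

theorem multiplier_mulMat {J : (Fin N → V) → ℝ}
    (hJinv : ∀ (Φ : Fin N → V), ∀ U ∈ Matrix.orthogonalGroup (Fin N) ℝ, J (mulMat Φ U) = J Φ)
    (Φ : Fin N → V) {U : Matrix (Fin N) (Fin N) ℝ}
    (hU : U ∈ Matrix.orthogonalGroup (Fin N) ℝ) :
    multiplier J (mulMat Φ U) = U.transpose * multiplier J Φ * U := by
  ext i j
  simp only [multiplier, Matrix.of_apply, grad_mulMat hJinv Φ hU, mulMat, map_sum, map_smul,
    sum_apply, smul_apply, smul_eq_mul, Matrix.mul_apply, Matrix.transpose_apply, Finset.sum_mul,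
    Finset.mul_sum]
  rw [Finset.sum_comm]
  refine Finset.sum_congr rfl fun k _ => Finset.sum_congr rfl fun l _ => ?_
  ring

theorem residual_mulMat (ι : V →L[ℝ] H) {J : (Fin N → V) → ℝ}
    (hJinv : ∀ (Φ : Fin N → V), ∀ U ∈ Matrix.orthogonalGroup (Fin N) ℝ, J (mulMat Φ U) = J Φ)
    (Φ : Fin N → V) {U : Matrix (Fin N) (Fin N) ℝ}
    (hU : U ∈ Matrix.orthogonalGroup (Fin N) ℝ) (j : Fin N) :
    residual ι J (mulMat Φ U) j = ∑ i, U i j • residual ι J Φ i := by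
  have h : mulMat (mulMat Φ U) (multiplier J (mulMat Φ U)) =
      mulMat (mulMat Φ (multiplier J Φ)) U := by
    rw [multiplier_mulMat hJinv Φ hU, mulMat_mulMat, mulMat_mulMat, ← Matrix.mul_assoc,
      ← Matrix.mul_assoc, mul_transpose_of_mem hU, Matrix.one_mul]
  simp only [residual, h, grad_mulMat hJinv Φ hU, smul_sub, Finset.sum_sub_distrib]
  congr 1
  simp [mulMat]

theorem residual_eq_complDual (ι : V →L[ℝ] H) (J : (Fin N → V) → ℝ) (Φ : Fin N → V)
    (i : Fin N) : residual ι J Φ i = complDual ι Φ (grad J Φ i) := by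
  simp [residual, complDual_apply, projDual_apply, mulMat, multiplier]

/-- The residual at an orthonormal family annihilates the span of the family. -/
theorem residual_apply_self {ι : V →L[ℝ] H} (J : (Fin N → V) → ℝ) {Φ : Fin N → V}
    (hΦ : Φ ∈ stiefel ι N) (i j : Fin N) : residual ι J Φ j (Φ i) = 0 := by
  rw [residual_eq_complDual, complDual_apply_apply, compl_basis hΦ, map_zero]

/-! ### Linearization of the residual at the minimizer -/

/-- The passage from functionals on `V^N` to families in `(V')^N`, as a continuous linear map. -/
def componentsL (V : Type*) [NormedAddCommGroup V] [InnerProductSpace ℝ V] (N : ℕ) :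
    StrongDual ℝ (Fin N → V) →L[ℝ] (Fin N → StrongDual ℝ V) :=
  ContinuousLinearMap.pi fun i =>
    (ContinuousLinearMap.compL ℝ V (Fin N → V) ℝ).flip
      (ContinuousLinearMap.single ℝ (fun _ : Fin N => V) i)

theorem componentsL_apply (F : StrongDual ℝ (Fin N → V)) : componentsL V N F = components F := rfl

/-- The Hessian of the Lagrangian at `Ψ`, as a continuous linear map. -/
def hessianL (ι : V →L[ℝ] H) (J : (Fin N → V) → ℝ) (Ψ : Fin N → V) :
    (Fin N → V) →L[ℝ] (Fin N → StrongDual ℝ V) :=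
  (componentsL V N).comp (fderiv ℝ (fderiv ℝ J) Ψ) -
    (ContinuousLinearMap.pi fun i => (toDual ι).comp
      ((ContinuousLinearMap.proj i).comp (mulMatL (multiplier J Ψ))))

theorem hessianL_apply (ι : V →L[ℝ] H) (J : (Fin N → V) → ℝ) (Ψ X : Fin N → V) :
    hessianL ι J Ψ X = lagrangeHessian ι J Ψ X := by
  ext i : 1
  simp [hessianL, lagrangeHessian, componentsL_apply, mulMatL_apply]

open Filter Topology Asymptotics

theorem isLittleO_comp_taylor {W F G : Type*} [NormedAddCommGroup W] [NormedSpace ℝ W]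
    [NormedAddCommGroup F] [NormedSpace ℝ F] [NormedAddCommGroup G] [NormedSpace ℝ G]
    (A : F →L[ℝ] G) {f : W → F} {x : W} (hf : DifferentiableAt ℝ f x) :
    (fun y => A (f y - f x - fderiv ℝ f x (y - x))) =o[𝓝 x] fun y => y - x :=
  (A.isBigO_comp (fun y => f y - f x - fderiv ℝ f x (y - x)) _).trans_isLittleO
    hf.hasFDerivAt.isLittleO

theorem tendsto_normalPart {ι : V →L[ℝ] H} {Ψ : Fin N → V} (hΨ : Ψ ∈ stiefel ι N)
    (s : Set (Fin N → V)) : Tendsto (normalPart ι Ψ) (𝓝[s] Ψ) (𝓝 0) := by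
  have := ((normalPart ι Ψ).continuous.tendsto Ψ).mono_left (nhdsWithin_le_nhds (s := s))
  rwa [normalPart_self hΨ] at this

theorem aligned_isLittleO {ι : V →L[ℝ] H} {Ψ : Fin N → V} (hΨ : Ψ ∈ stiefel ι N) (C : ℝ) :
    (fun Φ => Φ - Ψ - normalPart ι Ψ Φ) =o[𝓝[aligned ι Ψ C] Ψ] normalPart ι Ψ := by
  have h1 : (fun Φ => Φ - Ψ - normalPart ι Ψ Φ) =O[𝓝[aligned ι Ψ C] Ψ]
      fun Φ => ‖normalPart ι Ψ Φ‖ ^ 2 := by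
    refine IsBigO.of_bound C ?_
    filter_upwards [self_mem_nhdsWithin] with Φ hΦ
    simpa using hΦ.2
  refine h1.trans_isLittleO ?_
  have h2 := (isLittleO_norm_pow_id (E' := Fin N → V) one_lt_two).comp_tendsto
    (tendsto_normalPart hΨ (aligned ι Ψ C))
  exact h2

theorem aligned_isBigO {ι : V →L[ℝ] H} {Ψ : Fin N → V} (hΨ : Ψ ∈ stiefel ι N) (C : ℝ) :
    (fun Φ => Φ - Ψ) =O[𝓝[aligned ι Ψ C] Ψ] normalPart ι Ψ := by
  have h := (aligned_isLittleO hΨ C).isBigO.add (isBigO_refl (normalPart ι Ψ) _)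
  simpa using h

section Residual

variable {ι : V →L[ℝ] H} {J : (Fin N → V) → ℝ} {Ψ : Fin N → V}

theorem differentiableAt_fderiv (hJ : ContDiffAt ℝ 2 J Ψ) :
    DifferentiableAt ℝ (fderiv ℝ J) Ψ :=
  (hJ.fderiv_right (m := 1) (by norm_num)).differentiableAt (by norm_num)

theorem continuousAt_grad (hJ : ContDiffAt ℝ 2 J Ψ) (i : Fin N) :
    ContinuousAt (fun Φ => grad J Φ i) Ψ := by
  have h : Continuous fun F : StrongDual ℝ (Fin N → V) => (componentsL V N F : Fin N → _) i := by
    fun_prop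
  exact h.continuousAt.comp (differentiableAt_fderiv hJ).continuousAt

theorem continuousAt_multiplier (hJ : ContDiffAt ℝ 2 J Ψ) (i j : Fin N) :
    ContinuousAt (fun Φ => multiplier J Φ i j) Ψ :=
  (continuousAt_grad hJ j).clm_apply (continuous_apply i).continuousAt

theorem continuousAt_residual (hJ : ContDiffAt ℝ 2 J Ψ) (i : Fin N) :
    ContinuousAt (fun Φ => residual ι J Φ i) Ψ := by
  refine (continuousAt_grad hJ i).sub ?_
  refine (toDual ι).continuous.continuousAt.comp ?_
  refine tendsto_finsetSum _ fun k _ => ?_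
  exact (continuousAt_multiplier hJ k i).smul (continuous_apply k).continuousAt

theorem residual_minimizer [CompleteSpace V] (hΨ : Ψ ∈ stiefel ι N)
    (hmin : ∀ Φ ∈ stiefel ι N, J Ψ ≤ J Φ) (hJ : ContDiffAt ℝ 2 J Ψ) (i : Fin N) :
    residual ι J Ψ i = 0 := by
  rw [residual_eq_complDual]
  exact complDual_grad_eq_zero hΨ hmin (hJ.differentiableAt (by norm_num)) i

theorem complDual_toDual_mulMat (hΨ : Ψ ∈ stiefel ι N) (M : Matrix (Fin N) (Fin N) ℝ)
    (i : Fin N) : complDual ι Ψ (toDual ι (mulMat Ψ M i)) = 0 := by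
  ext v
  rw [complDual_apply_apply, toDual_apply, real_inner_comm]
  simp [mulMat, inner_sum, inner_smul_right, inner_compl hΨ]

theorem complDual_residual_isLittleO [CompleteSpace V] (hΨ : Ψ ∈ stiefel ι N)
    (hmin : ∀ Φ ∈ stiefel ι N, J Ψ ≤ J Φ) (hJ : ContDiffAt ℝ 2 J Ψ) (i : Fin N) :
    (fun Φ => complDual ι Ψ (residual ι J Φ i) - complDual ι Ψ (hessianL ι J Ψ (Φ - Ψ) i))
      =o[𝓝 Ψ] fun Φ => Φ - Ψ := by
  -- replacing `Φ Λ_Φ` by `(Φ - Ψ) Λ_Φ` is invisible under `I - D`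
  have hdec : ∀ Φ, complDual ι Ψ (residual ι J Φ i) - complDual ι Ψ (hessianL ι J Ψ (Φ - Ψ) i) =
      complDual ι Ψ (componentsL V N (fderiv ℝ J Φ - fderiv ℝ J Ψ
          - fderiv ℝ (fderiv ℝ J) Ψ (Φ - Ψ)) i)
        - ∑ k, (multiplier J Φ k i - multiplier J Ψ k i) •
          complDual ι Ψ (toDual ι (Φ k - Ψ k)) := by
    intro Φ
    have hg : complDual ι Ψ (components (fderiv ℝ J Ψ) i) = 0 :=
      complDual_grad_eq_zero hΨ hmin (hJ.differentiableAt (by norm_num)) i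
    have h0 : ∑ k, (multiplier J Φ k i) • complDual ι Ψ (toDual ι (Ψ k)) = 0 := by
      have := complDual_toDual_mulMat hΨ (multiplier J Φ) i
      simpa [mulMat] using this
    have e1 : complDual ι Ψ (residual ι J Φ i) = complDual ι Ψ (components (fderiv ℝ J Φ) i)
        - ∑ k, multiplier J Φ k i • complDual ι Ψ (toDual ι (Φ k)) := by
      simp [residual, grad, mulMat]
    have e2 : complDual ι Ψ (hessianL ι J Ψ (Φ - Ψ) i) =
        complDual ι Ψ (components (fderiv ℝ (fderiv ℝ J) Ψ (Φ - Ψ)) i)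
        - ∑ k, multiplier J Ψ k i • complDual ι Ψ (toDual ι (Φ k - Ψ k)) := by
      rw [hessianL_apply]
      simp only [lagrangeHessian, map_sub (complDual ι Ψ)]
      simp only [mulMat, map_sum, map_smul, Pi.sub_apply]
    rw [e1, e2]
    generalize fderiv ℝ (fderiv ℝ J) Ψ (Φ - Ψ) = Z
    simp only [map_sub, Pi.sub_apply, componentsL_apply, hg, sub_smul, smul_sub,
      Finset.sum_sub_distrib, h0]
    abel
  simp only [hdec]
  refine IsLittleO.sub ?_ (IsLittleO.fun_sum fun k _ => ?_)
  · let A : StrongDual ℝ (Fin N → V) →L[ℝ] StrongDual ℝ V :=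
      (complDual ι Ψ).comp ((ContinuousLinearMap.proj i).comp (componentsL V N))
    exact isLittleO_comp_taylor (W := Fin N → V) (F := (Fin N → V) →L[ℝ] ℝ) A (f := fderiv ℝ J)
      (x := Ψ) (differentiableAt_fderiv hJ)
  · have h1 : (fun Φ => multiplier J Φ k i - multiplier J Ψ k i) =o[𝓝 Ψ] fun _ => (1 : ℝ) := by
      rw [isLittleO_one_iff]
      have := (continuousAt_multiplier hJ k i).sub_const (multiplier J Ψ k i)
      simpa [ContinuousAt] using this
    let A : (Fin N → V) →L[ℝ] StrongDual ℝ V :=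
      (complDual ι Ψ).comp ((toDual ι).comp (ContinuousLinearMap.proj k))
    have h2 : (fun Φ : Fin N → V => A (Φ - Ψ)) =O[𝓝 Ψ] fun Φ => Φ - Ψ := A.isBigO_comp _ _
    have h3 := (h1.smul_isBigO h2)
    simp only [one_smul] at h3
    exact h3

/-- Along aligned families the residual is, to first order, the projected Hessian of the
Lagrangian applied to the normal part. The `D`-component is of higher order because the residual
annihilates the span of `Φ`. -/
theorem residual_isLittleO [CompleteSpace V] (hΨ : Ψ ∈ stiefel ι N)
    (hmin : ∀ Φ ∈ stiefel ι N, J Ψ ≤ J Φ) (hJ : ContDiffAt ℝ 2 J Ψ) (C : ℝ) (i : Fin N) :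
    (fun Φ => residual ι J Φ i - complDual ι Ψ (hessianL ι J Ψ (normalPart ι Ψ Φ) i))
      =o[𝓝[aligned ι Ψ C] Ψ] normalPart ι Ψ := by
  have hO := aligned_isBigO hΨ C
  have h1 := ((complDual_residual_isLittleO hΨ hmin hJ i).mono
    (nhdsWithin_le_nhds (s := aligned ι Ψ C))).trans_isBigO hO
  let A : (Fin N → V) →L[ℝ] StrongDual ℝ V :=
    (complDual ι Ψ).comp ((ContinuousLinearMap.proj i).comp (hessianL ι J Ψ))
  have h2 : (fun Φ => A (Φ - Ψ - normalPart ι Ψ Φ)) =o[𝓝[aligned ι Ψ C] Ψ] normalPart ι Ψ :=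
    (A.isBigO_comp (fun Φ => Φ - Ψ - normalPart ι Ψ Φ) _).trans_isLittleO (aligned_isLittleO hΨ C)
  have h3 : (fun Φ => ∑ k, residual ι J Φ i (Φ k - Ψ k) • toDual ι (Ψ k))
      =o[𝓝[aligned ι Ψ C] Ψ] normalPart ι Ψ := by
    refine IsLittleO.fun_sum fun k _ => ?_
    have hres : (fun Φ => residual ι J Φ i) =o[𝓝[aligned ι Ψ C] Ψ] fun _ => (1 : ℝ) := by
      rw [isLittleO_one_iff]
      have := (continuousAt_residual (ι := ι) hJ i).tendsto.mono_left
        (nhdsWithin_le_nhds (s := aligned ι Ψ C))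
      rwa [residual_minimizer hΨ hmin hJ] at this
    have hk : (fun Φ : Fin N → V => Φ k - Ψ k) =O[𝓝[aligned ι Ψ C] Ψ] normalPart ι Ψ :=
      (isBigO_pi.1 hO) k
    have hap : (fun Φ => residual ι J Φ i (Φ k - Ψ k)) =o[𝓝[aligned ι Ψ C] Ψ]
        fun Φ => ‖normalPart ι Ψ Φ‖ := by
      have hb : (fun Φ => residual ι J Φ i (Φ k - Ψ k)) =O[𝓝[aligned ι Ψ C] Ψ]
          fun Φ => ‖residual ι J Φ i‖ * ‖Φ k - Ψ k‖ :=
        IsBigO.of_bound 1 (Eventually.of_forall fun Φ => by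
          simpa using (residual ι J Φ i).le_opNorm (Φ k - Ψ k))
      have := hb.trans_isLittleO (hres.norm_left.mul_isBigO hk.norm_norm)
      simpa using this
    have hc : (fun _ : Fin N → V => toDual ι (Ψ k)) =O[𝓝[aligned ι Ψ C] Ψ] fun _ => (1 : ℝ) :=
      isBigO_const_one _ _ _
    have := hap.smul_isBigO hc
    simp only [smul_eq_mul, mul_one] at this
    exact this.of_norm_right
  have hsum := (h1.add h2).sub h3
  refine hsum.congr' ?_ EventuallyEq.rfl
  filter_upwards [self_mem_nhdsWithin] with Φ hΦ
  have hD : toDual ι (projDual Ψ (residual ι J Φ i)) =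
      -∑ k, residual ι J Φ i (Φ k - Ψ k) • toDual ι (Ψ k) := by
    rw [← Finset.sum_neg_distrib, projDual_apply, map_sum]
    refine Finset.sum_congr rfl fun k _ => ?_
    rw [map_smul, map_sub, residual_apply_self J hΦ.1, zero_sub]
    module
  have hR : residual ι J Φ i = complDual ι Ψ (residual ι J Φ i)
      + toDual ι (projDual Ψ (residual ι J Φ i)) := by
    simp [complDual_apply]
  have hA : A (Φ - Ψ - normalPart ι Ψ Φ) = complDual ι Ψ (hessianL ι J Ψ (Φ - Ψ) i)
      - complDual ι Ψ (hessianL ι J Ψ (normalPart ι Ψ Φ) i) := by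
    rw [map_sub]; rfl
  rw [hD] at hR
  rw [hA]
  conv_rhs => rw [hR]
  abel

theorem residual_isBigO [CompleteSpace V] (hΨ : Ψ ∈ stiefel ι N)
    (hmin : ∀ Φ ∈ stiefel ι N, J Ψ ≤ J Φ) (hJ : ContDiffAt ℝ 2 J Ψ) (C : ℝ) (i : Fin N) :
    (fun Φ => residual ι J Φ i) =O[𝓝[aligned ι Ψ C] Ψ] normalPart ι Ψ := by
  let A : (Fin N → V) →L[ℝ] StrongDual ℝ V :=
    (complDual ι Ψ).comp ((ContinuousLinearMap.proj i).comp (hessianL ι J Ψ))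
  have h := (residual_isLittleO hΨ hmin hJ C i).isBigO.add (A.isBigO_comp (normalPart ι Ψ) _)
  refine h.congr_left fun Φ => ?_
  simp [A]

end Residual

/-! ### Linearization of the three steps -/

/-- The preconditioned residual, projected onto the tangent space at `[Φ]`. -/
def direction (ι : V →L[ℝ] H) (J : (Fin N → V) → ℝ) (B : V →L[ℝ] StrongDual ℝ V)
    (Φ : Fin N → V) : Fin N → V :=
  fun i => compl ι Φ (B.inverse (residual ι J Φ i))

/-- The geodesic step in the direction of the projected preconditioned residual. -/
def geodesicStep (ι : V →L[ℝ] H) (J : (Fin N → V) → ℝ) (B : V →L[ℝ] StrongDual ℝ V) (s : ℝ)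
    (Φ : Fin N → V) : Fin N → V :=
  fun i => NormedSpace.exp (-(s • rotation ι Φ (direction ι J B Φ))) (Φ i)

theorem direction_mem_tangent {ι : V →L[ℝ] H} {Φ : Fin N → V} (hΦ : Φ ∈ stiefel ι N)
    (J : (Fin N → V) → ℝ) (B : V →L[ℝ] StrongDual ℝ V) : direction ι J B Φ ∈ tangent ι Φ :=
  mem_tangent_iff.2 fun _ j => inner_compl hΦ _ j

theorem inner_compl_left (ι : V →L[ℝ] H) (Φ : Fin N → V) (u v : V) :
    inner ℝ (ι (compl ι Φ u)) (ι v) = (inner ℝ (ι u) (ι (compl ι Φ v)) : ℝ) := by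
  have h := complDual_apply_apply ι Φ (toDual ι v) u
  rw [toDual_apply] at h
  rw [real_inner_comm, ← h]
  simp only [complDual_apply, compl_apply, sub_apply, map_sub, toDual_apply, inner_sub_right,
    proj, ContinuousLinearMap.comp_apply]
  rw [real_inner_comm, real_inner_comm (ι u) (ι (projDual Φ (toDual ι v)))]

/-- The operator of the geodesic step depends on `A` only through the gradient. -/
theorem antisymm_expOp_eq_rotation {ι : V →L[ℝ] H} {J : (Fin N → V) → ℝ} {Φ : Fin N → V}
    (hΦ : Φ ∈ stiefel ι N) (B A : V →L[ℝ] StrongDual ℝ V) (hA : ∀ i, grad J Φ i = A (Φ i)) :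
    antisymm ι Φ (expOp ι B A Φ) = rotation ι Φ (direction ι J B Φ) := by
  have hX : ∀ i, expOp ι B A Φ (Φ i) = direction ι J B Φ i := by
    intro i
    simp only [expOp, direction, ContinuousLinearMap.comp_apply, residual_eq_complDual, hA]
  have hC : ∀ i, compl ι Φ (direction ι J B Φ i) = direction ι J B Φ i :=
    fun i => compl_compl hΦ _
  ext v
  have h1 : antisymm ι Φ (expOp ι B A Φ) v = compl ι Φ (expOp ι B A Φ (proj ι Φ v))
      - projDual Φ (adj (expOp ι B A Φ) (toDual ι (compl ι Φ v))) := rfl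
  have h2 : ∀ f : StrongDual ℝ V, ∀ w, adj (expOp ι B A Φ) f w = f (expOp ι B A Φ w) :=
    fun _ _ => rfl
  rw [h1, rotation_apply, proj_apply, projDual_apply]
  simp only [map_sum, map_smul, h2, hX, hC, toDual_apply, inner_compl_left,
    Finset.sum_sub_distrib]
  simp only [real_inner_comm (ι v)]

theorem step₃_eq_geodesicStep {ι : V →L[ℝ] H} {J : (Fin N → V) → ℝ} {Φ : Fin N → V}
    (hΦ : Φ ∈ stiefel ι N) (B A : V →L[ℝ] StrongDual ℝ V) (s : ℝ)
    (hA : ∀ i, grad J Φ i = A (Φ i)) : step₃ ι B A s Φ = geodesicStep ι J B s Φ := by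
  ext i
  simp only [step₃, geodesicStep, antisymm_expOp_eq_rotation hΦ B A hA]

theorem geodesicStep_mem_stiefel [CompleteSpace V] {ι : V →L[ℝ] H} {Φ : Fin N → V}
    (hΦ : Φ ∈ stiefel ι N) (J : (Fin N → V) → ℝ) (B : V →L[ℝ] StrongDual ℝ V) (s : ℝ) :
    geodesicStep ι J B s Φ ∈ stiefel ι N := by
  have := exp_mem_stiefel (rotation_antisymm ι Φ (direction ι J B Φ)) hΦ (-s)
  rw [neg_smul] at this
  exact this

/-- The first order model `E - s (I - D) B⁻¹ (I - D) L E`, `E = (I - D) Φ`, for the normal part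
of the next iterate. -/
def linearStep (ι : V →L[ℝ] H) (J : (Fin N → V) → ℝ) (B : V →L[ℝ] StrongDual ℝ V) (s : ℝ)
    (Ψ Φ : Fin N → V) : Fin N → V :=
  fun i => normalPart ι Ψ Φ i - s • reducedInverse ι B Ψ (hessianL ι J Ψ (normalPart ι Ψ Φ) i)

section Steps

variable {ι : V →L[ℝ] H} {J : (Fin N → V) → ℝ} {Ψ : Fin N → V}

theorem apply_isBigO_one {W : Type*} [NormedAddCommGroup W] {Ψ : Fin N → W}
    (s : Set (Fin N → W)) (k : Fin N) :
    (fun Φ : Fin N → W => Φ k) =O[𝓝[s] Ψ] fun _ => (1 : ℝ) :=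
  (((continuous_apply k).tendsto Ψ).mono_left nhdsWithin_le_nhds).isBigO_one ℝ

theorem inverse_residual_isBigO [CompleteSpace V] (hΨ : Ψ ∈ stiefel ι N)
    (hmin : ∀ Φ ∈ stiefel ι N, J Ψ ≤ J Φ) (hJ : ContDiffAt ℝ 2 J Ψ)
    (B : V →L[ℝ] StrongDual ℝ V) (C : ℝ) (i : Fin N) :
    (fun Φ => B.inverse (residual ι J Φ i)) =O[𝓝[aligned ι Ψ C] Ψ] normalPart ι Ψ :=
  (B.inverse.isBigO_comp (fun Φ => residual ι J Φ i) _).trans (residual_isBigO hΨ hmin hJ C i)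

theorem inner_inverse_residual_isBigO [CompleteSpace V] (hΨ : Ψ ∈ stiefel ι N)
    (hmin : ∀ Φ ∈ stiefel ι N, J Ψ ≤ J Φ) (hJ : ContDiffAt ℝ 2 J Ψ)
    (B : V →L[ℝ] StrongDual ℝ V) (C : ℝ) (i k : Fin N) :
    (fun Φ => (inner ℝ (ι (B.inverse (residual ι J Φ i))) (ι (Φ k)) : ℝ))
      =O[𝓝[aligned ι Ψ C] Ψ] normalPart ι Ψ := by
  have h1 : (fun Φ => (inner ℝ (ι (B.inverse (residual ι J Φ i))) (ι (Φ k)) : ℝ))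
      =O[𝓝[aligned ι Ψ C] Ψ]
        fun Φ => ‖ι (B.inverse (residual ι J Φ i))‖ * ‖ι (Φ k)‖ :=
    IsBigO.of_bound 1 (Eventually.of_forall fun Φ => by
      simpa using abs_real_inner_le_norm (ι (B.inverse (residual ι J Φ i))) (ι (Φ k)))
  have h2 := (ι.isBigO_comp (fun Φ => B.inverse (residual ι J Φ i)) _).trans
    (inverse_residual_isBigO hΨ hmin hJ B C i)
  have h3 := (ι.isBigO_comp (fun Φ : Fin N → V => Φ k) _).trans
    (apply_isBigO_one (Ψ := Ψ) (aligned ι Ψ C) k)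
  have h4 := h1.trans (h2.norm_norm.mul h3.norm_left)
  simp only [mul_one] at h4
  exact h4.of_norm_right

theorem direction_isBigO [CompleteSpace V] (hΨ : Ψ ∈ stiefel ι N)
    (hmin : ∀ Φ ∈ stiefel ι N, J Ψ ≤ J Φ) (hJ : ContDiffAt ℝ 2 J Ψ)
    (B : V →L[ℝ] StrongDual ℝ V) (C : ℝ) :
    direction ι J B =O[𝓝[aligned ι Ψ C] Ψ] normalPart ι Ψ := by
  rw [isBigO_pi]
  intro i
  simp only [direction, compl_apply, proj_apply]
  refine (inverse_residual_isBigO hΨ hmin hJ B C i).sub (IsBigO.fun_sum fun k _ => ?_)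
  have h := (inner_inverse_residual_isBigO hΨ hmin hJ B C i k).norm_right.smul
    (apply_isBigO_one (Ψ := Ψ) (aligned ι Ψ C) k)
  simp only [smul_eq_mul, mul_one] at h
  exact h.of_norm_right

theorem compl_inverse_residual_isLittleO [CompleteSpace V] (hΨ : Ψ ∈ stiefel ι N)
    (hmin : ∀ Φ ∈ stiefel ι N, J Ψ ≤ J Φ) (hJ : ContDiffAt ℝ 2 J Ψ)
    (B : V →L[ℝ] StrongDual ℝ V) (C : ℝ) (i : Fin N) :
    (fun Φ => compl ι Ψ (B.inverse (residual ι J Φ i))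
        - reducedInverse ι B Ψ (hessianL ι J Ψ (normalPart ι Ψ Φ) i))
      =o[𝓝[aligned ι Ψ C] Ψ] normalPart ι Ψ := by
  let A : StrongDual ℝ V →L[ℝ] V := (compl ι Ψ).comp B.inverse
  have h := (A.isBigO_comp (fun Φ => residual ι J Φ i
    - complDual ι Ψ (hessianL ι J Ψ (normalPart ι Ψ Φ) i)) _).trans_isLittleO
    (residual_isLittleO hΨ hmin hJ C i)
  refine h.congr_left fun Φ => ?_
  rw [map_sub]
  rfl

theorem compl_direction_isLittleO [CompleteSpace V] (hΨ : Ψ ∈ stiefel ι N)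
    (hmin : ∀ Φ ∈ stiefel ι N, J Ψ ≤ J Φ) (hJ : ContDiffAt ℝ 2 J Ψ)
    (B : V →L[ℝ] StrongDual ℝ V) (C : ℝ) (i : Fin N) :
    (fun Φ => compl ι Ψ (direction ι J B Φ i)
        - reducedInverse ι B Ψ (hessianL ι J Ψ (normalPart ι Ψ Φ) i))
      =o[𝓝[aligned ι Ψ C] Ψ] normalPart ι Ψ := by
  have h1 : (fun Φ => ∑ k, (inner ℝ (ι (B.inverse (residual ι J Φ i))) (ι (Φ k)) : ℝ) •
      normalPart ι Ψ Φ k) =o[𝓝[aligned ι Ψ C] Ψ] normalPart ι Ψ := by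
    refine IsLittleO.fun_sum fun k _ => ?_
    have hz : (fun Φ => (inner ℝ (ι (B.inverse (residual ι J Φ i))) (ι (Φ k)) : ℝ))
        =o[𝓝[aligned ι Ψ C] Ψ] fun _ => (1 : ℝ) :=
      (inner_inverse_residual_isBigO hΨ hmin hJ B C i k).trans_isLittleO
        ((isLittleO_one_iff ℝ).2 (tendsto_normalPart hΨ _))
    have hk : (fun Φ => normalPart ι Ψ Φ k) =O[𝓝[aligned ι Ψ C] Ψ] normalPart ι Ψ :=
      isBigO_pi.1 (isBigO_refl (normalPart ι Ψ) _) k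
    have h := hz.smul_isBigO hk
    simp only [one_smul] at h
    exact h
  refine ((compl_inverse_residual_isLittleO hΨ hmin hJ B C i).sub h1).congr_left fun Φ => ?_
  have e : compl ι Ψ (direction ι J B Φ i) = compl ι Ψ (B.inverse (residual ι J Φ i))
      - ∑ k, (inner ℝ (ι (B.inverse (residual ι J Φ i))) (ι (Φ k)) : ℝ) •
        normalPart ι Ψ Φ k := by
    rw [direction, compl_apply ι Φ, map_sub, proj_apply, map_sum]
    simp only [map_smul, normalPart_apply]
  rw [e]
  abel

theorem step₁_isLittleO [CompleteSpace V] (hΨ : Ψ ∈ stiefel ι N)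
    (hmin : ∀ Φ ∈ stiefel ι N, J Ψ ≤ J Φ) (hJ : ContDiffAt ℝ 2 J Ψ)
    (B : V →L[ℝ] StrongDual ℝ V) (C : ℝ) :
    (fun Φ => normalPart ι Ψ (step₁ ι J B Φ) - linearStep ι J B 1 Ψ Φ)
      =o[𝓝[aligned ι Ψ C] Ψ] normalPart ι Ψ := by
  rw [isLittleO_pi]
  intro i
  refine (compl_inverse_residual_isLittleO hΨ hmin hJ B C i).neg_left.congr_left fun Φ => ?_
  simp only [Pi.sub_apply, normalPart_apply, step₁, linearStep, map_sub, one_smul]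
  abel

theorem step₂_isLittleO [CompleteSpace V] (hΨ : Ψ ∈ stiefel ι N)
    (hmin : ∀ Φ ∈ stiefel ι N, J Ψ ≤ J Φ) (hJ : ContDiffAt ℝ 2 J Ψ)
    (B : V →L[ℝ] StrongDual ℝ V) (C : ℝ) :
    (fun Φ => normalPart ι Ψ (step₂ ι J B Φ) - linearStep ι J B 1 Ψ Φ)
      =o[𝓝[aligned ι Ψ C] Ψ] normalPart ι Ψ := by
  rw [isLittleO_pi]
  intro i
  refine (compl_direction_isLittleO hΨ hmin hJ B C i).neg_left.congr_left fun Φ => ?_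
  simp only [Pi.sub_apply, normalPart_apply, step₂, linearStep, map_sub, one_smul, direction]
  abel

theorem geodesicStep_isLittleO_sub [CompleteSpace V] (hΨ : Ψ ∈ stiefel ι N)
    (hmin : ∀ Φ ∈ stiefel ι N, J Ψ ≤ J Φ) (hJ : ContDiffAt ℝ 2 J Ψ)
    (B : V →L[ℝ] StrongDual ℝ V) (C s : ℝ) :
    (fun Φ => geodesicStep ι J B s Φ - (Φ - s • direction ι J B Φ))
      =o[𝓝[aligned ι Ψ C] Ψ] normalPart ι Ψ := by
  set Z : (Fin N → V) → V →L[ℝ] V := fun Φ => -(s • rotation ι Φ (direction ι J B Φ)) with hZ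
  have hZO : Z =O[𝓝[aligned ι Ψ C] Ψ] normalPart ι Ψ := by
    have h1 : Z =O[𝓝[aligned ι Ψ C] Ψ] fun Φ => ‖Φ‖ * ‖direction ι J B Φ‖ := by
      refine IsBigO.of_bound (|s| * (N * (2 * ‖toDual ι‖))) (Eventually.of_forall fun Φ => ?_)
      simp only [hZ, norm_neg, norm_smul, norm_mul, norm_norm]
      rw [Real.norm_eq_abs]
      calc |s| * ‖rotation ι Φ (direction ι J B Φ)‖
          ≤ |s| * (N * (2 * ‖toDual ι‖) * ‖Φ‖ * ‖direction ι J B Φ‖) := by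
            gcongr; exact norm_rotation_le _ _ _
        _ = _ := by ring
    have h2 : (fun Φ : Fin N → V => Φ) =O[𝓝[aligned ι Ψ C] Ψ] fun _ => (1 : ℝ) :=
      (tendsto_id.mono_left nhdsWithin_le_nhds).isBigO_one ℝ
    have h3 := h1.trans (h2.norm_left.mul (direction_isBigO hΨ hmin hJ B C).norm_norm)
    simp only [one_mul] at h3
    exact h3.of_norm_right
  have hZ0 : Tendsto Z (𝓝[aligned ι Ψ C] Ψ) (𝓝 0) :=
    hZO.trans_tendsto (tendsto_normalPart hΨ _)
  have hexp : (fun Z : V →L[ℝ] V => NormedSpace.exp Z - 1 - Z) =o[𝓝 0] fun Z => Z := by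
    have := (hasFDerivAt_exp_zero (𝕂 := ℝ) (𝔸 := V →L[ℝ] V)).isLittleO
    simpa using this
  have hrem : (fun Φ => NormedSpace.exp (Z Φ) - 1 - Z Φ) =o[𝓝[aligned ι Ψ C] Ψ]
      normalPart ι Ψ := (hexp.comp_tendsto hZ0).trans_isBigO hZO
  rw [isLittleO_pi]
  intro i
  have h1 : (fun Φ => (NormedSpace.exp (Z Φ) - 1 - Z Φ) (Φ i)) =O[𝓝[aligned ι Ψ C] Ψ]
      fun Φ => ‖NormedSpace.exp (Z Φ) - 1 - Z Φ‖ * ‖Φ i‖ :=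
    IsBigO.of_bound 1 (Eventually.of_forall fun Φ => by
      simpa using (NormedSpace.exp (Z Φ) - 1 - Z Φ).le_opNorm (Φ i))
  have h2 := h1.trans_isLittleO
    (hrem.norm_norm.mul_isBigO (apply_isBigO_one (Ψ := Ψ) (aligned ι Ψ C) i).norm_left)
  simp only [mul_one] at h2
  refine h2.of_norm_right.congr' ?_ EventuallyEq.rfl
  filter_upwards [self_mem_nhdsWithin] with Φ hΦ
  have e : Z Φ (Φ i) = -(s • direction ι J B Φ i) := by
    simp only [hZ, neg_apply, smul_apply,
      rotation_basis hΦ.1 (direction_mem_tangent hΦ.1 J B)]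
  rw [sub_apply, sub_apply, e]
  simp only [one_apply_eq_self, Pi.sub_apply, Pi.smul_apply, geodesicStep, hZ]
  abel

theorem geodesicStep_isLittleO [CompleteSpace V] (hΨ : Ψ ∈ stiefel ι N)
    (hmin : ∀ Φ ∈ stiefel ι N, J Ψ ≤ J Φ) (hJ : ContDiffAt ℝ 2 J Ψ)
    (B : V →L[ℝ] StrongDual ℝ V) (C s : ℝ) :
    (fun Φ => normalPart ι Ψ (geodesicStep ι J B s Φ) - linearStep ι J B s Ψ Φ)
      =o[𝓝[aligned ι Ψ C] Ψ] normalPart ι Ψ := by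
  have h1 := ((normalPart ι Ψ).isBigO_comp (fun Φ => geodesicStep ι J B s Φ
    - (Φ - s • direction ι J B Φ)) _).trans_isLittleO
    (geodesicStep_isLittleO_sub hΨ hmin hJ B C s)
  rw [isLittleO_pi] at h1 ⊢
  intro i
  refine ((h1 i).sub ((compl_direction_isLittleO hΨ hmin hJ B C i).const_smul_left s)).congr_left
    fun Φ => ?_
  simp only [Pi.sub_apply, Pi.smul_apply, normalPart_apply, linearStep, map_sub, map_smul, smul_sub]
  abel

theorem tendsto_step₁ [CompleteSpace V] (hΨ : Ψ ∈ stiefel ι N)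
    (hmin : ∀ Φ ∈ stiefel ι N, J Ψ ≤ J Φ) (hJ : ContDiffAt ℝ 2 J Ψ)
    (B : V →L[ℝ] StrongDual ℝ V) (C : ℝ) :
    Tendsto (step₁ ι J B) (𝓝[aligned ι Ψ C] Ψ) (𝓝 Ψ) := by
  rw [tendsto_pi_nhds]
  intro i
  have h1 : Tendsto (fun Φ : Fin N → V => Φ i) (𝓝[aligned ι Ψ C] Ψ) (𝓝 (Ψ i)) :=
    ((continuous_apply i).tendsto Ψ).mono_left nhdsWithin_le_nhds
  have h2 := (inverse_residual_isBigO hΨ hmin hJ B C i).trans_tendsto (tendsto_normalPart hΨ _)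
  simpa [step₁] using h1.sub h2

theorem tendsto_step₂ [CompleteSpace V] (hΨ : Ψ ∈ stiefel ι N)
    (hmin : ∀ Φ ∈ stiefel ι N, J Ψ ≤ J Φ) (hJ : ContDiffAt ℝ 2 J Ψ)
    (B : V →L[ℝ] StrongDual ℝ V) (C : ℝ) :
    Tendsto (step₂ ι J B) (𝓝[aligned ι Ψ C] Ψ) (𝓝 Ψ) := by
  have h1 : Tendsto (fun Φ : Fin N → V => Φ) (𝓝[aligned ι Ψ C] Ψ) (𝓝 Ψ) :=
    tendsto_id.mono_left nhdsWithin_le_nhds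
  have h2 := (direction_isBigO hΨ hmin hJ B C).trans_tendsto (tendsto_normalPart hΨ _)
  have h3 := h1.sub h2
  rw [sub_zero] at h3
  exact h3

end Steps

/-! ### Equivariance of the steps -/

section Equivariance

variable (ι : V →L[ℝ] H) {J : (Fin N → V) → ℝ}

theorem step₁_mulMat
    (hJinv : ∀ (Φ : Fin N → V), ∀ U ∈ Matrix.orthogonalGroup (Fin N) ℝ, J (mulMat Φ U) = J Φ)
    (B : V →L[ℝ] StrongDual ℝ V) (Φ : Fin N → V) {U : Matrix (Fin N) (Fin N) ℝ}
    (hU : U ∈ Matrix.orthogonalGroup (Fin N) ℝ) :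
    step₁ ι J B (mulMat Φ U) = mulMat (step₁ ι J B Φ) U := by
  ext j
  simp [step₁, residual_mulMat ι hJinv Φ hU, mulMat, smul_sub]

theorem direction_mulMat
    (hJinv : ∀ (Φ : Fin N → V), ∀ U ∈ Matrix.orthogonalGroup (Fin N) ℝ, J (mulMat Φ U) = J Φ)
    (B : V →L[ℝ] StrongDual ℝ V) (Φ : Fin N → V) {U : Matrix (Fin N) (Fin N) ℝ}
    (hU : U ∈ Matrix.orthogonalGroup (Fin N) ℝ) :
    direction ι J B (mulMat Φ U) = mulMat (direction ι J B Φ) U := by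
  ext j
  simp [direction, residual_mulMat ι hJinv Φ hU, compl_mulMat ι Φ hU, mulMat]

theorem step₂_mulMat
    (hJinv : ∀ (Φ : Fin N → V), ∀ U ∈ Matrix.orthogonalGroup (Fin N) ℝ, J (mulMat Φ U) = J Φ)
    (B : V →L[ℝ] StrongDual ℝ V) (Φ : Fin N → V) {U : Matrix (Fin N) (Fin N) ℝ}
    (hU : U ∈ Matrix.orthogonalGroup (Fin N) ℝ) :
    step₂ ι J B (mulMat Φ U) = mulMat (step₂ ι J B Φ) U := by
  ext j
  have h := congrFun (direction_mulMat ι hJinv B Φ hU) j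
  simp only [direction] at h
  have h' : ∀ i, step₂ ι J B Φ i = Φ i - direction ι J B Φ i := fun _ => rfl
  simp only [step₂, h]
  simp [mulMat, smul_sub, h']

theorem rotation_mulMat (Φ W : Fin N → V) {U : Matrix (Fin N) (Fin N) ℝ}
    (hU : U ∈ Matrix.orthogonalGroup (Fin N) ℝ) :
    rotation ι (mulMat Φ U) (mulMat W U) = rotation ι Φ W := by
  ext v
  have key : ∀ X Y : Fin N → V, ∑ j, (inner ℝ (ι (mulMat X U j)) (ι v) : ℝ) • mulMat Y U j =
      ∑ i, (inner ℝ (ι (X i)) (ι v) : ℝ) • Y i := by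
    intro X Y
    calc ∑ j, (inner ℝ (ι (mulMat X U j)) (ι v) : ℝ) • mulMat Y U j
        = ∑ j, ∑ k, ∑ i, (U i j * U k j) • (inner ℝ (ι (X i)) (ι v) : ℝ) • Y k := by
          refine Finset.sum_congr rfl fun j _ => ?_
          simp only [mulMat, map_sum, map_smul, sum_inner, inner_smul_left,
            Finset.smul_sum, conj_trivial, smul_smul]
          refine Finset.sum_congr rfl fun k _ => ?_
          rw [Finset.sum_mul, Finset.sum_smul]
          refine Finset.sum_congr rfl fun i _ => ?_
          congr 1
          ring
      _ = ∑ k, ∑ i, (∑ j, U i j * U k j) • (inner ℝ (ι (X i)) (ι v) : ℝ) • Y k := by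
          rw [Finset.sum_comm]
          refine Finset.sum_congr rfl fun k _ => ?_
          rw [Finset.sum_comm]
          refine Finset.sum_congr rfl fun i _ => ?_
          rw [Finset.sum_smul]
      _ = _ := by simp [sum_row_mul_row hU]
  simp only [rotation_apply, Finset.sum_sub_distrib, key]

theorem geodesicStep_mulMat
    (hJinv : ∀ (Φ : Fin N → V), ∀ U ∈ Matrix.orthogonalGroup (Fin N) ℝ, J (mulMat Φ U) = J Φ)
    (B : V →L[ℝ] StrongDual ℝ V) (s : ℝ) (Φ : Fin N → V) {U : Matrix (Fin N) (Fin N) ℝ}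
    (hU : U ∈ Matrix.orthogonalGroup (Fin N) ℝ) :
    geodesicStep ι J B s (mulMat Φ U) = mulMat (geodesicStep ι J B s Φ) U := by
  ext j
  have h : ∀ i, geodesicStep ι J B s Φ i =
    NormedSpace.exp (-(s • rotation ι Φ (direction ι J B Φ))) (Φ i) := fun _ => rfl
  simp only [geodesicStep, direction_mulMat ι hJinv B Φ hU, rotation_mulMat ι _ _ hU]
  simp [mulMat, h]

end Equivariance

/-! ### Contraction of the error -/

/-- A remainder of higher order than the normal part costs an arbitrarily small loss in the
contraction factor. -/
theorem eventually_energy_le {T : V →L[ℝ] StrongDual ℝ V} (hT : IsPreconditioner T)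
    {l : Filter (Fin N → V)} {E G F : (Fin N → V) → (Fin N → V)}
    (hF : (fun Φ => F Φ - G Φ) =o[l] E) {κ κ' : ℝ} (hκ1 : κ < 1) (hκ' : κ < κ')
    (hG : ∀ Φ, energy T (G Φ) ≤ κ * energy T (E Φ)) :
    ∀ᶠ Φ in l, energy T (F Φ) ≤ κ' * energy T (E Φ) := by
  obtain ⟨c, C, hc, hC, hcC⟩ := exists_energy_bounds hT N
  set ε : ℝ := (κ' - κ) / 2 with hε
  have hε0 : 0 < ε := by rw [hε]; linarith
  set ρ : ℝ := √(c * ε / (C * (1 + ε⁻¹))) with hρ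
  have hρ0 : 0 < ρ := Real.sqrt_pos.2 (by positivity)
  have hρsq : ρ ^ 2 = c * ε / (C * (1 + ε⁻¹)) := Real.sq_sqrt (by positivity)
  filter_upwards [hF.def hρ0] with Φ hΦ
  have h1 := energy_add_le hT hε0 (G Φ) (F Φ - G Φ)
  rw [add_sub_cancel] at h1
  have h2 : (1 + ε⁻¹) * energy T (F Φ - G Φ) ≤ ε * energy T (E Φ) := by
    calc (1 + ε⁻¹) * energy T (F Φ - G Φ) ≤ (1 + ε⁻¹) * (C * (ρ * ‖E Φ‖) ^ 2) := by
          gcongr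
          exact (hcC _).2.trans (by gcongr)
      _ = ε * (c * ‖E Φ‖ ^ 2) := by
          rw [mul_pow, hρsq]; field_simp
      _ ≤ _ := by gcongr; exact (hcC _).1
  have hE := energy_nonneg hT (E Φ)
  have h3 : (1 + ε) * energy T (G Φ) ≤ (κ + ε) * energy T (E Φ) := by
    calc (1 + ε) * energy T (G Φ) ≤ (1 + ε) * (κ * energy T (E Φ)) := by gcongr; exact hG Φ
      _ = (κ + ε * κ) * energy T (E Φ) := by ring
      _ ≤ (κ + ε * 1) * energy T (E Φ) := by gcongr
      _ = _ := by rw [mul_one]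
  have h4 : κ' = κ + ε + ε := by rw [hε]; ring
  rw [h4]
  linarith

theorem lower_bound_of_mulMat {ι : V →L[ℝ] H} {Φ : Fin N → V} {U : Matrix (Fin N) (Fin N) ℝ}
    (hU : U ∈ Matrix.orthogonalGroup (Fin N) ℝ) {c : ℝ}
    (h : ∀ x : Fin N → ℝ, c * ∑ i, x i ^ 2 ≤ ‖ι (∑ i, x i • mulMat Φ U i)‖ ^ 2)
    (x : Fin N → ℝ) : c * ∑ i, x i ^ 2 ≤ ‖ι (∑ i, x i • Φ i)‖ ^ 2 := by
  have h1 := h fun j => ∑ i, U i j * x i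
  have e1 : ∑ j, (∑ i, U i j * x i) • mulMat Φ U j = ∑ i, x i • Φ i := by
    have hΦ : ∀ i, Φ i = ∑ j, U i j • mulMat Φ U j := fun i =>
      (congrFun (mulMat_mul_transpose hU Φ) i).symm
    calc ∑ j, (∑ i, U i j * x i) • mulMat Φ U j = ∑ i, ∑ j, (U i j * x i) • mulMat Φ U j := by
          simp only [Finset.sum_smul]
          exact Finset.sum_comm
      _ = ∑ i, x i • ∑ j, U i j • mulMat Φ U j := by
          simp only [Finset.smul_sum, smul_smul, mul_comm]
      _ = ∑ i, x i • Φ i := Finset.sum_congr rfl fun i _ => by rw [← hΦ i]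
  have e2 : ∑ j, (∑ i, U i j * x i) ^ 2 = ∑ i, x i ^ 2 := by
    simpa [mul_comm] using sum_sq_sum_mul hU x
  rwa [e1, e2] at h1

/-- The starting condition `d([Φ], [Ψ]) < δ` bounds the error. -/
theorem exists_error_lt_of_dist_lt [CompleteSpace V] {ι : V →L[ℝ] H}
    {B : V →L[ℝ] StrongDual ℝ V} (hB : IsPreconditioner B) {Ψ : Fin N → V}
    (hΨ : Ψ ∈ stiefel ι N) {ε : ℝ} (hε : 0 < ε) :
    ∃ δ : ℝ, 0 < δ ∧ ∀ Φ : Fin N → V, dist ι B Ψ Φ < δ → error ι B Ψ Φ < ε := by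
  set T := (hatInv ι B Ψ).inverse with hTdef
  have hT : IsPreconditioner T := isPreconditioner_hat ι hB Ψ
  obtain ⟨c, C, hc, hC, hcC⟩ := exists_energy_bounds hT N
  set M : ℝ := C * (‖normalPart ι Ψ‖ ^ 2 / c) + 1 with hM
  have hM0 : 0 < M := by positivity
  refine ⟨ε / √M, by positivity, fun Φ hΦ => ?_⟩
  obtain ⟨U, hU⟩ := exists_lt_of_ciInf_lt hΦ
  set Y := Φ - mulMat Ψ (U : Matrix (Fin N) (Fin N) ℝ) with hY
  have hYE : normalPart ι Ψ Y = normalPart ι Ψ Φ := by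
    rw [hY, map_sub, normalPart_mulMat, normalPart_self hΨ]
    have : mulMat (0 : Fin N → V) (U : Matrix (Fin N) (Fin N) ℝ) = 0 := by
      ext j; simp [mulMat]
    rw [this, sub_zero]
  have hle : energy T (normalPart ι Ψ Φ) ≤ M * energy T Y := by
    have hY0 := energy_nonneg hT Y
    have h1 : ‖Y‖ ^ 2 ≤ energy T Y / c := by
      rw [le_div_iff₀ hc, mul_comm]; exact (hcC Y).1
    calc energy T (normalPart ι Ψ Φ) ≤ C * ‖normalPart ι Ψ Y‖ ^ 2 := by
          rw [hYE]; exact (hcC _).2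
      _ ≤ C * (‖normalPart ι Ψ‖ * ‖Y‖) ^ 2 := by
          gcongr; exact (normalPart ι Ψ).le_opNorm Y
      _ = C * (‖normalPart ι Ψ‖ ^ 2 * ‖Y‖ ^ 2) := by rw [mul_pow]
      _ ≤ C * (‖normalPart ι Ψ‖ ^ 2 * (energy T Y / c)) := by gcongr
      _ = (M - 1) * energy T Y := by rw [hM]; ring
      _ ≤ M * energy T Y := by gcongr; linarith
  calc error ι B Ψ Φ = √(energy T (normalPart ι Ψ Φ)) := rfl
    _ ≤ √(M * energy T Y) := Real.sqrt_le_sqrt hle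
    _ = √M * √(energy T Y) := Real.sqrt_mul hM0.le _
    _ < √M * (ε / √M) := by
        have : √(energy T Y) < ε / √M := hU
        gcongr
    _ = ε := by field_simp

/-- The basin of attraction: orthonormal families with small error are preserved by an iteration
that contracts the error there. -/
theorem error_contraction_of_step {ι : V →L[ℝ] H} {B : V →L[ℝ] StrongDual ℝ V} {Ψ : Fin N → V}
    {ε χ : ℝ} (hχ : χ < 1) {Φ : ℕ → Fin N → V} (h0 : Φ 0 ∈ stiefel ι N)
    (hε : error ι B Ψ (Φ 0) < ε)
    (hstep : ∀ n, Φ n ∈ stiefel ι N → error ι B Ψ (Φ n) < ε →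
      Φ (n + 1) ∈ stiefel ι N ∧ error ι B Ψ (Φ (n + 1)) ≤ χ * error ι B Ψ (Φ n)) (n : ℕ) :
    Φ n ∈ stiefel ι N ∧ error ι B Ψ (Φ n) < ε := by
  induction n with
  | zero => exact ⟨h0, hε⟩
  | succ n ih =>
    obtain ⟨h1, h2⟩ := hstep n ih.1 ih.2
    refine ⟨h1, lt_of_le_of_lt ?_ ih.2⟩
    have h3 : 0 ≤ error ι B Ψ (Φ n) := Real.sqrt_nonneg _
    nlinarith

/-- Transfer of an eventual estimate for an equivariant map from the aligned families to all
orthonormal families with a small error. -/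
theorem exists_error_bound_of_eventually [CompleteSpace V] {ι : V →L[ℝ] H}
    {B : V →L[ℝ] StrongDual ℝ V} (hB : IsPreconditioner B) {Ψ : Fin N → V}
    {C : ℝ} (hC : ∀ p : (Fin N → V) → Prop, (∀ᶠ Φ in 𝓝[aligned ι Ψ C] Ψ, p Φ) →
      ∃ ε : ℝ, 0 < ε ∧ ∀ Φ ∈ stiefel ι N, ‖normalPart ι Ψ Φ‖ < ε →
        ∃ U ∈ Matrix.orthogonalGroup (Fin N) ℝ, mulMat Φ U ∈ stiefel ι N ∧ p (mulMat Φ U))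
    {p : (Fin N → V) → Prop} (hp : ∀ᶠ Φ in 𝓝[aligned ι Ψ C] Ψ, p Φ) :
    ∃ ε : ℝ, 0 < ε ∧ ∀ Φ ∈ stiefel ι N, error ι B Ψ Φ < ε →
      ∃ U ∈ Matrix.orthogonalGroup (Fin N) ℝ, mulMat Φ U ∈ stiefel ι N ∧ p (mulMat Φ U) := by
  obtain ⟨ε, hε, h⟩ := hC p hp
  obtain ⟨c, C', hc, -, hcC⟩ := exists_energy_bounds (isPreconditioner_hat ι hB Ψ) N
  refine ⟨√c * ε, by positivity, fun Φ hΦ herr => h Φ hΦ ?_⟩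
  have h1 : √c * ‖normalPart ι Ψ Φ‖ ≤ error ι B Ψ Φ := by
    rw [← Real.sqrt_sq (norm_nonneg (normalPart ι Ψ Φ)), ← Real.sqrt_mul hc.le]
    exact Real.sqrt_le_sqrt (hcC _).1
  exact lt_of_mul_lt_mul_left (h1.trans_lt herr) (Real.sqrt_nonneg c)

/-! ### Local linear convergence -/

section Convergence

variable {ι : V →L[ℝ] H} {J : (Fin N → V) → ℝ} {Ψ : Fin N → V}

/-- Local linear convergence of a gradient step followed by an arbitrary orthonormalization. -/
theorem linear_convergence_of_step [CompleteSpace V] {B : V →L[ℝ] StrongDual ℝ V}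
    (hB : IsPreconditioner B) (hΨ : Ψ ∈ stiefel ι N) {κ s : ℝ} (hκ0 : 0 ≤ κ) (hκ1 : κ < 1)
    (hlin : ∀ X ∈ tangent ι Ψ, energy (hatInv ι B Ψ).inverse
        (fun i => X i - s • reducedInverse ι B Ψ (hessianL ι J Ψ X i)) ≤
          κ * energy (hatInv ι B Ψ).inverse X)
    {F : (Fin N → V) → (Fin N → V)}
    (hequiv : ∀ Φ, ∀ U ∈ Matrix.orthogonalGroup (Fin N) ℝ, F (mulMat Φ U) = mulMat (F Φ) U)
    (hF : ∀ C, (fun Φ => normalPart ι Ψ (F Φ) - linearStep ι J B s Ψ Φ)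
      =o[𝓝[aligned ι Ψ C] Ψ] normalPart ι Ψ)
    (hF' : ∀ C, Tendsto F (𝓝[aligned ι Ψ C] Ψ) (𝓝 Ψ)) :
    ∃ δ : ℝ, 0 < δ ∧ ∃ χ : ℝ, 0 ≤ χ ∧ χ < 1 ∧
      ∀ P : ℕ → (Fin N → V) → (Fin N → V), (∀ n, IsOrthonormalization ι (P n)) →
      ∀ Φ : ℕ → Fin N → V, Φ 0 ∈ stiefel ι N → dist ι B Ψ (Φ 0) < δ →
        (∀ n, Φ (n + 1) = P n (F (Φ n))) →
      ∀ n, LinearIndependent ℝ (F (Φ n)) ∧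
        error ι B Ψ (Φ (n + 1)) ≤ χ * error ι B Ψ (Φ n) := by
  set T := (hatInv ι B Ψ).inverse with hTdef
  have hT : IsPreconditioner T := isPreconditioner_hat ι hB Ψ
  -- `κ'` absorbs the remainder of the linearization, `c` the cost of the orthonormalization
  obtain ⟨κ', hκκ', hκ'1⟩ := exists_between hκ1
  obtain ⟨c, hκ'c, hc1⟩ := exists_between hκ'1
  have hκ'0 : 0 < κ' := hκ0.trans_lt hκκ'
  have hc0 : 0 < c := hκ'0.trans hκ'c
  obtain ⟨C, hC⟩ := exists_aligned hΨ
  have hev := (eventually_energy_le hT (hF C) hκ1 hκκ'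
    (fun Φ => hlin _ (normalPart_mem_tangent hΨ Φ))).and
    ((hF' C).eventually (eventually_lower_bound hΨ hc1))
  obtain ⟨ε, hε, hloc⟩ := exists_error_bound_of_eventually hB hC hev
  obtain ⟨δ, hδ, hdist⟩ := exists_error_lt_of_dist_lt hB hΨ hε
  set χ : ℝ := √(c⁻¹ * κ') with hχ
  have hχ1 : χ < 1 := by
    rw [hχ, Real.sqrt_lt' one_pos, one_pow, inv_mul_lt_iff₀ hc0, mul_one]
    exact hκ'c
  -- one step, for any orthonormal family with a small error
  have hone : ∀ Φ ∈ stiefel ι N, error ι B Ψ Φ < ε → LinearIndependent ℝ (F Φ) ∧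
      ∀ Φ' ∈ stiefel ι N,
        Submodule.span ℝ (Set.range Φ') = Submodule.span ℝ (Set.range (F Φ)) →
        error ι B Ψ Φ' ≤ χ * error ι B Ψ Φ := by
    intro Φ hΦ herr
    obtain ⟨U, hU, -, hen, hlow⟩ := hloc Φ hΦ herr
    rw [hequiv Φ U hU] at hen hlow
    rw [normalPart_mulMat, normalPart_mulMat, energy_mulMat hT _ hU, energy_mulMat hT _ hU] at hen
    have hlow' := lower_bound_of_mulMat hU hlow
    refine ⟨linearIndependent_of_lower_bound hc0 hlow', fun Φ' hΦ' hspan => ?_⟩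
    have h1 := energy_orthonormalization_le hT hc0 hlow' hΦ' hspan (compl ι Ψ)
    calc error ι B Ψ Φ' = √(energy T (fun i => compl ι Ψ (Φ' i))) := rfl
      _ ≤ √(c⁻¹ * κ' * energy T (normalPart ι Ψ Φ)) := by
          refine Real.sqrt_le_sqrt (h1.trans ?_)
          rw [mul_assoc]
          gcongr
          exact hen
      _ = χ * error ι B Ψ Φ := Real.sqrt_mul (by positivity) _
  refine ⟨δ, hδ, χ, Real.sqrt_nonneg _, hχ1, fun P hP Φ h0 hd hiter => ?_⟩
  have hstep : ∀ n, Φ n ∈ stiefel ι N → error ι B Ψ (Φ n) < ε →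
      Φ (n + 1) ∈ stiefel ι N ∧ error ι B Ψ (Φ (n + 1)) ≤ χ * error ι B Ψ (Φ n) := by
    intro n hn herr
    obtain ⟨hli, hcontr⟩ := hone _ hn herr
    obtain ⟨hmem, hspan⟩ := hP n _ hli
    rw [hiter n]
    exact ⟨hmem, hcontr _ hmem hspan⟩
  intro n
  obtain ⟨hn, herr⟩ := error_contraction_of_step hχ1 h0 (hdist _ hd) hstep n
  exact ⟨(hone _ hn herr).1, (hstep n hn herr).2⟩

/-- Local linear convergence of the geodesic steps, which need no orthonormalization. -/
theorem linear_convergence_of_geodesicStep [CompleteSpace V] {B : V →L[ℝ] StrongDual ℝ V}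
    (hB : IsPreconditioner B) (hΨ : Ψ ∈ stiefel ι N) {κ s : ℝ} (hκ0 : 0 ≤ κ) (hκ1 : κ < 1)
    (hlin : ∀ X ∈ tangent ι Ψ, energy (hatInv ι B Ψ).inverse
        (fun i => X i - s • reducedInverse ι B Ψ (hessianL ι J Ψ X i)) ≤
          κ * energy (hatInv ι B Ψ).inverse X)
    (hJinv : ∀ (Φ : Fin N → V), ∀ U ∈ Matrix.orthogonalGroup (Fin N) ℝ, J (mulMat Φ U) = J Φ)
    (hmin : ∀ Φ ∈ stiefel ι N, J Ψ ≤ J Φ) (hJ : ContDiffAt ℝ 2 J Ψ) :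
    ∃ δ : ℝ, 0 < δ ∧ ∃ χ : ℝ, 0 ≤ χ ∧ χ < 1 ∧
      ∀ A : (Fin N → V) → V →L[ℝ] StrongDual ℝ V,
        (∀ Φ ∈ stiefel ι N, DifferentiableAt ℝ J Φ → ∀ i, grad J Φ i = A Φ (Φ i)) →
      ∀ Φ : ℕ → Fin N → V, Φ 0 ∈ stiefel ι N → dist ι B Ψ (Φ 0) < δ →
        (∀ n, Φ (n + 1) = step₃ ι B (A (Φ n)) s (Φ n)) →
      ∀ n, error ι B Ψ (Φ (n + 1)) ≤ χ * error ι B Ψ (Φ n) := by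
  set T := (hatInv ι B Ψ).inverse with hTdef
  have hT : IsPreconditioner T := isPreconditioner_hat ι hB Ψ
  obtain ⟨κ', hκκ', hκ'1⟩ := exists_between hκ1
  have hκ'0 : 0 < κ' := hκ0.trans_lt hκκ'
  obtain ⟨C, hC⟩ := exists_aligned hΨ
  have hdiff : ∀ᶠ Φ in 𝓝[aligned ι Ψ C] Ψ, DifferentiableAt ℝ J Φ :=
    ((hJ.eventually (by norm_num)).mono fun Φ h => h.differentiableAt (by norm_num)).filter_mono
      nhdsWithin_le_nhds
  have hev := (eventually_energy_le hT (geodesicStep_isLittleO hΨ hmin hJ B C s) hκ1 hκκ'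
    (fun Φ => hlin _ (normalPart_mem_tangent hΨ Φ))).and hdiff
  obtain ⟨ε, hε, hloc⟩ := exists_error_bound_of_eventually hB hC hev
  obtain ⟨δ, hδ, hdist⟩ := exists_error_lt_of_dist_lt hB hΨ hε
  set χ : ℝ := √κ' with hχ
  have hχ1 : χ < 1 := by
    rw [hχ, Real.sqrt_lt' one_pos, one_pow]
    exact hκ'1
  refine ⟨δ, hδ, χ, Real.sqrt_nonneg _, hχ1, fun A hA Φ h0 hd hiter => ?_⟩
  have hstep : ∀ n, Φ n ∈ stiefel ι N → error ι B Ψ (Φ n) < ε →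
      Φ (n + 1) ∈ stiefel ι N ∧ error ι B Ψ (Φ (n + 1)) ≤ χ * error ι B Ψ (Φ n) := by
    intro n hn herr
    obtain ⟨U, hU, -, hen, hd⟩ := hloc _ hn herr
    rw [geodesicStep_mulMat ι hJinv B s _ hU, normalPart_mulMat, normalPart_mulMat,
      energy_mulMat hT _ hU, energy_mulMat hT _ hU] at hen
    have hd' : DifferentiableAt ℝ J (Φ n) := by
      have hJe : J = J ∘ mulMatL U := by
        ext X
        rw [Function.comp_apply, mulMatL_apply, hJinv X U hU]
      rw [hJe]
      have h1 : DifferentiableAt ℝ (mulMatL U : (Fin N → V) → (Fin N → V)) (Φ n) := by fun_prop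
      refine DifferentiableAt.comp (Φ n) ?_ h1
      rwa [mulMatL_apply]
    rw [hiter n, step₃_eq_geodesicStep hn B _ s (hA _ hn hd')]
    refine ⟨geodesicStep_mem_stiefel hn J B s, ?_⟩
    calc error ι B Ψ (geodesicStep ι J B s (Φ n))
        = √(energy T (normalPart ι Ψ (geodesicStep ι J B s (Φ n)))) := rfl
      _ ≤ √(κ' * energy T (normalPart ι Ψ (Φ n))) := Real.sqrt_le_sqrt hen
      _ = χ * error ι B Ψ (Φ n) := Real.sqrt_mul hκ'0.le _
  intro n
  obtain ⟨hn, herr⟩ := error_contraction_of_step hχ1 h0 (hdist _ hd) hstep n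
  exact (hstep n hn herr).2

end Convergence

end Grassmann

end

theorem theorem5p1 {V H : Type*} [NormedAddCommGroup V] [InnerProductSpace ℝ V]
    [CompleteSpace V] [NormedAddCommGroup H] [InnerProductSpace ℝ H]
    (ι : V →L[ℝ] H) (hι : Function.Injective ι) (N : ℕ)
    (J : (Fin N → V) → ℝ)
    (hJinv : ∀ (Φ : Fin N → V), ∀ U ∈ Matrix.orthogonalGroup (Fin N) ℝ,
      J (Grassmann.mulMat Φ U) = J Φ)
    (Ψ : Fin N → V) (hΨ : Ψ ∈ Grassmann.stiefel ι N)
    (hmin : ∀ Φ ∈ Grassmann.stiefel ι N, J Ψ ≤ J Φ)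
    (hJ : ContDiffAt ℝ 2 J Ψ)
    (hell : Grassmann.EllipticOnTangent ι J Ψ)
    (B : V →L[ℝ] StrongDual ℝ V) (hB : Grassmann.IsPreconditioner B) :
    ∃ α₀ : ℝ, 0 < α₀ ∧
      -- projected gradient descent
      (∀ α : ℝ, α₀ ≤ α → ∃ δ : ℝ, 0 < δ ∧ ∃ χ : ℝ, 0 ≤ χ ∧ χ < 1 ∧
        ∀ P : ℕ → (Fin N → V) → (Fin N → V),
          (∀ n, Grassmann.IsOrthonormalization ι (P n)) →
        ∀ Φ : ℕ → Fin N → V, Φ 0 ∈ Grassmann.stiefel ι N →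
          Grassmann.dist ι (α • B) Ψ (Φ 0) < δ →
          (∀ n, Φ (n + 1) = P n (Grassmann.step₁ ι J (α • B) (Φ n))) →
        ∀ n, LinearIndependent ℝ (Grassmann.step₁ ι J (α • B) (Φ n)) ∧
          Grassmann.error ι (α • B) Ψ (Φ (n + 1)) ≤
            χ * Grassmann.error ι (α • B) Ψ (Φ n)) ∧
      -- projected gradient descent with the direction projected onto the tangent space
      (∀ α : ℝ, α₀ ≤ α → ∃ δ : ℝ, 0 < δ ∧ ∃ χ : ℝ, 0 ≤ χ ∧ χ < 1 ∧
        ∀ P : ℕ → (Fin N → V) → (Fin N → V),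
          (∀ n, Grassmann.IsOrthonormalization ι (P n)) →
        ∀ Φ : ℕ → Fin N → V, Φ 0 ∈ Grassmann.stiefel ι N →
          Grassmann.dist ι (α • B) Ψ (Φ 0) < δ →
          (∀ n, Φ (n + 1) = P n (Grassmann.step₂ ι J (α • B) (Φ n))) →
        ∀ n, LinearIndependent ℝ (Grassmann.step₂ ι J (α • B) (Φ n)) ∧
          Grassmann.error ι (α • B) Ψ (Φ (n + 1)) ≤
            χ * Grassmann.error ι (α • B) Ψ (Φ n)) ∧
      -- preconditioned geodesic steps of stepsize `s`
      (∀ α s : ℝ, 0 < s → α₀ * s ≤ α → ∃ δ : ℝ, 0 < δ ∧ ∃ χ : ℝ, 0 ≤ χ ∧ χ < 1 ∧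
        ∀ A : (Fin N → V) → V →L[ℝ] StrongDual ℝ V,
          (∀ Φ ∈ Grassmann.stiefel ι N, DifferentiableAt ℝ J Φ →
            ∀ i, Grassmann.grad J Φ i = A Φ (Φ i)) →
        ∀ Φ : ℕ → Fin N → V, Φ 0 ∈ Grassmann.stiefel ι N →
          Grassmann.dist ι (α • B) Ψ (Φ 0) < δ →
          (∀ n, Φ (n + 1) = Grassmann.step₃ ι (α • B) (A (Φ n)) s (Φ n)) →
        ∀ n, Grassmann.error ι (α • B) Ψ (Φ (n + 1)) ≤
          χ * Grassmann.error ι (α • B) Ψ (Φ n)) := by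
  obtain ⟨γ, hγ, hell⟩ := hell
  obtain ⟨α₀, hα₀, hlin⟩ := Grassmann.exists_linear_contraction hB hΨ
    (Grassmann.hessianL ι J Ψ) hγ (fun X hX => by
      rw [Grassmann.hessianL_apply]; exact hell X hX)
  refine ⟨α₀, hα₀, fun α hα => ?_, fun α hα => ?_, fun α s hs hα => ?_⟩
  · obtain ⟨κ, hκ0, hκ1, hκ⟩ := hlin α 1 one_pos (by rwa [mul_one])
    have hBα := hB.smul (hα₀.trans_le hα)
    exact Grassmann.linear_convergence_of_step hBα hΨ hκ0 hκ1 hκ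
      (fun Φ U hU => Grassmann.step₁_mulMat ι hJinv _ Φ hU)
      (Grassmann.step₁_isLittleO hΨ hmin hJ _) (Grassmann.tendsto_step₁ hΨ hmin hJ _)
  · obtain ⟨κ, hκ0, hκ1, hκ⟩ := hlin α 1 one_pos (by rwa [mul_one])
    have hBα := hB.smul (hα₀.trans_le hα)
    exact Grassmann.linear_convergence_of_step hBα hΨ hκ0 hκ1 hκ
      (fun Φ U hU => Grassmann.step₂_mulMat ι hJinv _ Φ hU)
      (Grassmann.step₂_isLittleO hΨ hmin hJ _) (Grassmann.tendsto_step₂ hΨ hmin hJ _)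
  · obtain ⟨κ, hκ0, hκ1, hκ⟩ := hlin α s hs hα
    have hBα := hB.smul ((mul_pos hα₀ hs).trans_le hα)
    exact Grassmann.linear_convergence_of_geodesicStep hBα hΨ hκ0 hκ1 hκ hJinv hmin hJ
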